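/- For a prime power $q=p^m$ and integers $r\le n$ let $\mathcal H_n^{(r)}(\mathbb F_q)$ be the $\mathbb F_q$-vector space of all maps from the set of $r$-element subsets of $\{0,\dots,n-1\}$ to the field $\mathbb F_q$ with $q$ elements. For $2\le s<r\le n$ let $\Psi_{q,n}^{(s,r)}:\mathcal H_n^{(s)}(\mathbb F_q)\to\mathcal H_n^{(r)}(\mathbb F_q)$ be the linear map $$(\Psi_{q,n}^{(s,r)}f)(e)=\sum_{e'\subseteq e,\ |e'|=s}f(e').$$ There is an algorithm that, for all $2\le s<r\le n$, all prime powers $q=p^m$ and all $g\in\mathcal H_n^{(r)}(\mathbb F_q)$, decides whether $g\in\operatorname{Im}\Psi_{q,n}^{(s,r)}$, and whose running time is bounded (a) by a fixed polynomial in $\binom ns+\binom nr+\log q$, and (b) for every fixed pair $s<r$, by a polynomial (depending only on $s,r$) in the bit length of the input. Here an algorithm is a program for a random access machine on natural numbers with addition, truncated subtraction, multiplication, integer division and indirect addressing, and its running time is the logarithmic cost (each operation costs the bit lengths of its operands, result and addresses); in (a), $\log q$ stands for the bit length of $q$. The input consists of $p,m,n,s,r$ followed by the table of $g$: the list, in an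 arbitrary order, of all $r$-subsets $e$ (each as the increasing list of its vertices), each followed by the colour $g(e)$, written as its $m$ coordinates in $\{0,\dots,p-1\}$ with respect to an $\mathbb F_p$-basis of $\mathbb F_q$. -/

import Mathlib

universe u

/-! ### Hyperedge colourings and the lifting map -/

/-- The hyperedges of the complete `r`-uniform hypergraph on the vertex set `Fin n`. -/
abbrev Hyperedge (n r : ℕ) : Type := {e : Finset (Fin n) // e.card = r}

/-- The vector space of `F`-hyperedge colourings of the complete `r`-uniform hypergraph of
order `n`. -/
abbrev HyperedgeColoring (F : Type*) (n r : ℕ) : Type _ := Hyperedge n r → F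

/-- The lifting map: the colour of an `r`-set `e` is the sum of the colours of all `s`-element
subsets of `e`. -/
def liftingMap (F : Type*) [Field F] (n s r : ℕ) :
    HyperedgeColoring F n s →ₗ[F] HyperedgeColoring F n r where
  toFun f := fun e => ∑ e' : Hyperedge n s with e'.1 ⊆ e.1, f e'
  map_add' f g := by
    funext e
    simp [Finset.sum_add_distrib]
  map_smul' a f := by
    funext e
    simp [Finset.mul_sum]

/-! ### A random access machine with logarithmic cost

Programs are structured programs over registers and arrays (indexed by natural numbers) that hold
natural numbers. A program mentions only finitely many registers and arrays. Every evaluation of a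
constant, a register, an array cell or an arithmetic operation is charged the bit length of its
value, so that the cost of an operation accounts for the lengths of its operands, of its result and
of all addresses involved. -/

namespace RAM

/-- The bit length of a natural number, plus one (so that every operation has positive cost). -/
def bitLen (a : ℕ) : ℕ := Nat.size a + 1

/-- A memory state: the contents of the registers and of the arrays. -/
structure State where
  reg : ℕ → ℕ
  arr : ℕ → ℕ → ℕ

/-- Arithmetic operations: addition, truncated subtraction, multiplication, integer division
(with `a / 0 = 0`). -/
inductive Op
  | add
  | sub
  | mul
  | div

def Op.eval : Op → ℕ → ℕ → ℕ
  | .add, a, b => a + b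
  | .sub, a, b => a - b
  | .mul, a, b => a * b
  | .div, a, b => a / b

/-- Expressions: constants, registers, array cells, arithmetic operations. -/
inductive Expr
  | lit (k : ℕ)
  | reg (x : ℕ)
  | arr (k : ℕ) (i : Expr)
  | bin (o : Op) (a b : Expr)

def Expr.eval (σ : State) : Expr → ℕ
  | .lit k => k
  | .reg x => σ.reg x
  | .arr k i => σ.arr k (i.eval σ)
  | .bin o a b => o.eval (a.eval σ) (b.eval σ)

/-- The logarithmic cost of evaluating an expression. -/
def Expr.cost (σ : State) : Expr → ℕ
  | .lit k => bitLen k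
  | .reg x => bitLen (σ.reg x)
  | .arr k i => i.cost σ + bitLen (σ.arr k (i.eval σ))
  | .bin o a b => a.cost σ + b.cost σ + bitLen (o.eval (a.eval σ) (b.eval σ))

/-- Programs. The tests in `ite` and `loop` (a while loop) succeed when the value is nonzero. -/
inductive Prog
  | skip
  | set (x : ℕ) (e : Expr)
  | store (k : ℕ) (i e : Expr)
  | seq (c d : Prog)
  | ite (e : Expr) (c d : Prog)
  | loop (e : Expr) (c : Prog)

/-- Write the value `v` to register `x`. -/
def State.setReg (σ : State) (x v : ℕ) : State :=
  { σ with reg := Function.update σ.reg x v }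

/-- Write the value `v` to cell `i` of array `k`. -/
def State.setArr (σ : State) (k i v : ℕ) : State :=
  { σ with arr := Function.update σ.arr k (Function.update (σ.arr k) i v) }

/-- `Runs c σ τ t`: started in the state `σ`, the program `c` halts in the state `τ`, and the total
cost of this computation is `t`. -/
inductive Runs : Prog → State → State → ℕ → Prop
  | skip (σ : State) : Runs .skip σ σ 1
  | set (σ : State) (x : ℕ) (e : Expr) :
      Runs (.set x e) σ (σ.setReg x (e.eval σ)) (e.cost σ + 1)
  | store (σ : State) (k : ℕ) (i e : Expr) :
      Runs (.store k i e) σ (σ.setArr k (i.eval σ) (e.eval σ)) (i.cost σ + e.cost σ + 1)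
  | seq {c d : Prog} {σ τ υ : State} {t u : ℕ} :
      Runs c σ τ t → Runs d τ υ u → Runs (.seq c d) σ υ (t + u)
  | iteTrue {e : Expr} {c d : Prog} {σ τ : State} {t : ℕ} :
      e.eval σ ≠ 0 → Runs c σ τ t → Runs (.ite e c d) σ τ (e.cost σ + t + 1)
  | iteFalse {e : Expr} {c d : Prog} {σ τ : State} {t : ℕ} :
      e.eval σ = 0 → Runs d σ τ t → Runs (.ite e c d) σ τ (e.cost σ + t + 1)
  | loopTrue {e : Expr} {c : Prog} {σ τ υ : State} {t u : ℕ} :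
      e.eval σ ≠ 0 → Runs c σ τ t → Runs (.loop e c) τ υ u →
        Runs (.loop e c) σ υ (e.cost σ + t + u + 1)
  | loopFalse {e : Expr} {c : Prog} {σ : State} :
      e.eval σ = 0 → Runs (.loop e c) σ σ (e.cost σ + 1)

/-- The machine is deterministic: final state and cost are determined by the initial state. -/
theorem Runs.deterministic {c : Prog} {σ τ τ' : State} {t t' : ℕ}
    (h : Runs c σ τ t) (h' : Runs c σ τ' t') : τ = τ' ∧ t = t' := by
  induction h generalizing τ' t' with
  | skip => cases h'; exact ⟨rfl, rfl⟩
  | set => cases h'; exact ⟨rfl, rfl⟩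
  | store => cases h'; exact ⟨rfl, rfl⟩
  | seq _ _ ih₁ ih₂ =>
    cases h' with
    | seq h₁ h₂ =>
      obtain ⟨rfl, rfl⟩ := ih₁ h₁
      obtain ⟨rfl, rfl⟩ := ih₂ h₂
      exact ⟨rfl, rfl⟩
  | iteTrue he _ ih =>
    cases h' with
    | iteTrue _ h₁ =>
      obtain ⟨rfl, rfl⟩ := ih h₁
      exact ⟨rfl, rfl⟩
    | iteFalse he' _ => exact absurd he' he
  | iteFalse he _ ih =>
    cases h' with
    | iteTrue he' _ => exact absurd he he'
    | iteFalse _ h₁ =>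
      obtain ⟨rfl, rfl⟩ := ih h₁
      exact ⟨rfl, rfl⟩
  | loopTrue he _ _ ih₁ ih₂ =>
    cases h' with
    | loopTrue _ h₁ h₂ =>
      obtain ⟨rfl, rfl⟩ := ih₁ h₁
      obtain ⟨rfl, rfl⟩ := ih₂ h₂
      exact ⟨rfl, rfl⟩
    | loopFalse he' => exact absurd he' he
  | loopFalse he =>
    cases h' with
    | loopTrue he' _ _ => exact absurd he he'
    | loopFalse _ => exact ⟨rfl, rfl⟩

/-- The initial state on an input (a finite list of natural numbers): array `0` holds the input,
register `0` its number of entries, everything else is `0`. -/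
def State.init (input : List ℕ) : State where
  reg x := if x = 0 then input.length else 0
  arr k i := if k = 0 then input.getD i 0 else 0

/-- The length of an input in bits. -/
def inputLength (input : List ℕ) : ℕ := (input.map bitLen).sum

/-- On the given input the program halts at cost at most `T`, and register `0` finally holds `1` if
`P` is true and `0` if `P` is false. -/
def Prog.DecidesWithin (c : Prog) (input : List ℕ) (T : ℕ) (P : Prop) : Prop :=
  ∃ (τ : State) (t : ℕ), Runs c (State.init input) τ t ∧ t ≤ T ∧
    (P → τ.reg 0 = 1) ∧ (¬ P → τ.reg 0 = 0)

end RAM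

/-- The input that describes a colouring `g` of the `r`-subsets of an `n`-set and the parameter `s`:
first `p, m, n, s, r`; then, for each hyperedge `e` in the list `L`, the `r` vertices of `e` in
increasing order followed by the colour `g e`, written as its `m` coordinates (integers in
`{0, …, p - 1}`) with respect to the basis `b` of the field over its prime field. -/
noncomputable def coloringInput {p m : ℕ} {F : Type*} [Field F] [Algebra (ZMod p) F]
    (b : Module.Basis (Fin m) (ZMod p) F) (n s r : ℕ) (L : List (Hyperedge n r))
    (g : HyperedgeColoring F n r) : List ℕ :=
  [p, m, n, s, r] ++ L.flatMap fun e =>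
    (e.1.sort (· ≤ ·)).map Fin.val ++ List.ofFn fun j => (b.repr (g e) j).val

namespace RAM

/-! Membership in the image is solvability of a linear system whose matrix is the inclusion matrix
of `s`-sets in `r`-sets. Its entries are 0 and 1, so they lie in the prime field, and the system
over `F` splits along the basis into `m` systems over `ZMod p` with the same matrix and the
coordinates of `g` as right-hand sides (`mem_range_liftingMap_iff_coord`,
`mem_range_liftingMap_iff`).

The program writes this matrix with its `m` extra columns and eliminates. Rows and columns are
scaled by pivots, never divided, so no modular inverse is computed. Each pivot step preserves
solvability for every right-hand side (`flatSolvable_eliminate`), and after scanning all pivots the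
coefficient columns are zero (`eliminate_eq_zero`); the system is then solvable exactly when the
extra columns are zero too.

The unknowns must be listed without passing through all `2 ^ n` masks. Subsets are therefore built
one element at a time, keeping only partial subsets that extend to an `s`-set; the number of
extensions is conserved by Pascal's rule, so the list never exceeds `n.choose s`
(`PartialSubsets.le_choose`).

For the cost, all stored numbers stay below `2 ^ E` with `E` quadratic in the size parameter, while
the number of steps is of fourth order. Together this gives a polynomial of degree six
(`decideImage_decidesWithin`). For fixed `s` the size parameter is itself polynomial in the input
length (`size_le_inputLength`). -/

instance : Add Expr := ⟨Expr.bin .add⟩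
instance : Sub Expr := ⟨Expr.bin .sub⟩
instance : Mul Expr := ⟨Expr.bin .mul⟩
instance : Div Expr := ⟨Expr.bin .div⟩
/-- The remainder, as an expression in the available operations. -/
instance : Mod Expr := ⟨fun a b => a - a / b * b⟩

@[simp] theorem Expr.eval_lit (σ : State) (k : ℕ) : (Expr.lit k).eval σ = k := rfl
@[simp] theorem Expr.eval_reg (σ : State) (x : ℕ) : (Expr.reg x).eval σ = σ.reg x := rfl
@[simp] theorem Expr.eval_arr (σ : State) (k : ℕ) (i : Expr) :
    (Expr.arr k i).eval σ = σ.arr k (i.eval σ) := rfl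
@[simp] theorem Expr.eval_add (σ : State) (a b : Expr) :
    (a + b).eval σ = a.eval σ + b.eval σ := rfl
@[simp] theorem Expr.eval_sub (σ : State) (a b : Expr) :
    (a - b).eval σ = a.eval σ - b.eval σ := rfl
@[simp] theorem Expr.eval_mul (σ : State) (a b : Expr) :
    (a * b).eval σ = a.eval σ * b.eval σ := rfl
@[simp] theorem Expr.eval_div (σ : State) (a b : Expr) :
    (a / b).eval σ = a.eval σ / b.eval σ := rfl
@[simp] theorem Expr.eval_mod (σ : State) (a b : Expr) :
    (a % b).eval σ = a.eval σ % b.eval σ := by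
  change a.eval σ - a.eval σ / b.eval σ * b.eval σ = _
  have := Nat.mod_add_div' (a.eval σ) (b.eval σ)
  omega

@[simp] theorem State.reg_setReg (σ : State) (x v y : ℕ) :
    (σ.setReg x v).reg y = if y = x then v else σ.reg y := by
  simp [State.setReg, Function.update_apply]
@[simp] theorem State.arr_setReg (σ : State) (x v k : ℕ) : (σ.setReg x v).arr k = σ.arr k := rfl
@[simp] theorem State.reg_setArr (σ : State) (k i v : ℕ) : (σ.setArr k i v).reg = σ.reg := rfl
@[simp] theorem State.arr_setArr (σ : State) (k i v l : ℕ) :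
    (σ.setArr k i v).arr l = if l = k then Function.update (σ.arr l) i v else σ.arr l := by
  by_cases h : l = k
  · subst h; simp [State.setArr]
  · simp [State.setArr, h]

/-! ### Bounds on values and costs of expressions -/

/-- All registers and all array cells hold numbers at most `2 ^ E`. -/
def State.Bdd (E : ℕ) (σ : State) : Prop :=
  (∀ x, σ.reg x ≤ 2 ^ E) ∧ ∀ k i, σ.arr k i ≤ 2 ^ E

theorem State.Bdd.setReg {E : ℕ} {σ : State} (h : σ.Bdd E) {x v : ℕ} (hv : v ≤ 2 ^ E) :
    (σ.setReg x v).Bdd E := by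
  refine ⟨fun y => ?_, h.2⟩
  rw [State.reg_setReg]
  split
  · exact hv
  · exact h.1 y

theorem State.Bdd.setArr {E : ℕ} {σ : State} (h : σ.Bdd E) {k i v : ℕ} (hv : v ≤ 2 ^ E) :
    (σ.setArr k i v).Bdd E := by
  refine ⟨h.1, fun l c => ?_⟩
  rw [State.arr_setArr]
  split
  · rw [Function.update_apply]
    split
    · exact hv
    · exact h.2 _ _
  · exact h.2 _ _

/-- A size of expressions that controls both the values and the cost of the evaluation. -/
def Expr.weight : Expr → ℕ
  | .lit k => k + 1
  | .reg _ => 1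
  | .arr _ i => i.weight + 1
  | .bin _ a b => 2 * (a.weight + b.weight)

theorem Expr.weight_pos (e : Expr) : 0 < e.weight := by
  induction e <;> simp only [Expr.weight] <;> omega

theorem bitLen_le {E w a : ℕ} (hw : 0 < w) (h : a ≤ 2 ^ (E * w)) : bitLen a ≤ w * (E + 2) := by
  have h1 : a < 2 ^ (E * w + 1) := lt_of_le_of_lt h (Nat.pow_lt_pow_right (by norm_num) (by omega))
  have := Nat.size_le.2 h1
  unfold bitLen
  nlinarith

/-- Intermediate values may exceed `2 ^ E`, but each operation at most adds exponents, up to one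
carry bit; the factor 2 in `Expr.weight` absorbs the carry. -/
theorem Expr.eval_le {E : ℕ} (hE : 0 < E) {σ : State} (h : σ.Bdd E) (e : Expr) :
    e.eval σ ≤ 2 ^ (E * e.weight) := by
  have mono : ∀ {a b : ℕ}, a ≤ b → 2 ^ (E * a) ≤ 2 ^ (E * b) := fun hab =>
    Nat.pow_le_pow_right (by norm_num) (Nat.mul_le_mul_left _ hab)
  induction e with
  | lit k =>
    calc k ≤ 2 ^ k := Nat.lt_two_pow_self.le
      _ ≤ _ := Nat.pow_le_pow_right (by norm_num) (by simp only [Expr.weight]; nlinarith)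
  | reg x => simpa [Expr.weight] using h.1 x
  | arr k i ih =>
    refine (h.2 _ _).trans ?_
    have := mono (show 1 ≤ i.weight + 1 by omega)
    rwa [mul_one] at this
  | bin o a b iha ihb =>
    have ha := a.weight_pos
    have hb := b.weight_pos
    simp only [Expr.weight]
    have hadd : a.eval σ + b.eval σ ≤ 2 ^ (E * (2 * (a.weight + b.weight))) := by
      have h1 := iha.trans (mono (show a.weight ≤ a.weight + b.weight by omega))
      have h2 := ihb.trans (mono (show b.weight ≤ a.weight + b.weight by omega))
      calc a.eval σ + b.eval σ ≤ 2 ^ (E * (a.weight + b.weight) + 1) := by rw [pow_succ]; omega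
        _ ≤ _ := Nat.pow_le_pow_right (by norm_num) (by nlinarith)
    cases o with
    | add => exact hadd
    | sub => exact le_trans (by simp only [Expr.eval, Op.eval]; omega) hadd
    | mul =>
      calc a.eval σ * b.eval σ ≤ 2 ^ (E * a.weight) * 2 ^ (E * b.weight) := Nat.mul_le_mul iha ihb
        _ = 2 ^ (E * (a.weight + b.weight)) := by rw [← pow_add, mul_add]
        _ ≤ _ := mono (by omega)
    | div => exact le_trans ((Nat.div_le_self _ _).trans (Nat.le_add_right _ _)) hadd

/-- In a binary operation, half of the doubled weight pays for the operands and the other half for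
the bit length of the result. -/
theorem Expr.cost_le {E : ℕ} (hE : 0 < E) {σ : State} (h : σ.Bdd E) (e : Expr) :
    e.cost σ ≤ e.weight * (E + 2) := by
  induction e with
  | lit k => exact bitLen_le (Expr.weight_pos _) (Expr.eval_le hE h (.lit k))
  | reg x => exact bitLen_le (Expr.weight_pos _) (Expr.eval_le hE h (.reg x))
  | arr k i ih =>
    have := bitLen_le (E := E) one_pos (by simpa using h.2 k (i.eval σ))
    simp only [Expr.cost, Expr.weight]
    linarith
  | bin o a b iha ihb =>
    have ha := a.weight_pos
    have := bitLen_le (E := E) (w := a.weight + b.weight) (a := o.eval (a.eval σ) (b.eval σ))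
      (by omega) ?_
    · simp only [Expr.cost, Expr.weight]
      linarith
    · have hb := b.weight_pos
      have h1 := Expr.eval_le hE h a
      have h2 := Expr.eval_le hE h b
      have h3 : a.eval σ + b.eval σ ≤ 2 ^ (E * (a.weight + b.weight)) := by
        rw [mul_add, pow_add]
        have : 2 ≤ 2 ^ (E * a.weight) := by
          simpa using Nat.pow_le_pow_right (show 0 < 2 by norm_num)
            (Nat.mul_pos hE ha : 1 ≤ E * a.weight)
        have : 2 ≤ 2 ^ (E * b.weight) := by
          simpa using Nat.pow_le_pow_right (show 0 < 2 by norm_num)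
            (Nat.mul_pos hE hb : 1 ≤ E * b.weight)
        nlinarith
      cases o with
      | add => exact h3
      | sub => exact le_trans (by simp only [Op.eval]; omega) h3
      | mul =>
        rw [mul_add, pow_add]
        exact Nat.mul_le_mul h1 h2
      | div => exact le_trans ((Nat.div_le_self _ _).trans (Nat.le_add_right _ _)) h3

/-- A size of programs that bounds the cost of an elementary step. -/
def Prog.weight : Prog → ℕ
  | .skip => 1
  | .set _ e => e.weight + 1
  | .store _ i e => i.weight + e.weight + 1
  | .seq c d => c.weight + d.weight
  | .ite e c d => e.weight + c.weight + d.weight + 1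
  | .loop e c => e.weight + c.weight + 1

/-- The registers that a program may write to. -/
def Prog.regs : Prog → List ℕ
  | .skip => []
  | .set x _ => [x]
  | .store _ _ _ => []
  | .seq c d => c.regs ++ d.regs
  | .ite _ c d => c.regs ++ d.regs
  | .loop _ c => c.regs

/-- The arrays that a program may write to. -/
def Prog.arrs : Prog → List ℕ
  | .skip => []
  | .set _ _ => []
  | .store k _ _ => [k]
  | .seq c d => c.arrs ++ d.arrs
  | .ite _ c d => c.arrs ++ d.arrs
  | .loop _ c => c.arrs

/-- The states `σ` and `τ` agree outside the registers in `X` and the arrays in `A`. -/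
def Frame (X A : List ℕ) (σ τ : State) : Prop :=
  (∀ x, x ∉ X → τ.reg x = σ.reg x) ∧ ∀ k, k ∉ A → τ.arr k = σ.arr k

theorem Frame.refl (X A : List ℕ) (σ : State) : Frame X A σ σ :=
  ⟨fun _ _ => rfl, fun _ _ => rfl⟩

theorem Frame.trans {X A : List ℕ} {σ τ υ : State} (h : Frame X A σ τ) (h' : Frame X A τ υ) :
    Frame X A σ υ :=
  ⟨fun x hx => (h'.1 x hx).trans (h.1 x hx), fun k hk => (h'.2 k hk).trans (h.2 k hk)⟩

theorem Frame.mono {X A X' A' : List ℕ} {σ τ : State} (h : Frame X A σ τ) (hX : X ⊆ X')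
    (hA : A ⊆ A') : Frame X' A' σ τ :=
  ⟨fun x hx => h.1 x fun h' => hx (hX h'), fun k hk => h.2 k fun h' => hk (hA h')⟩

theorem Frame.setReg {X A : List ℕ} {σ τ : State} (h : Frame X A σ τ) {x v : ℕ} (hx : x ∈ X) :
    Frame X A σ (τ.setReg x v) := by
  refine ⟨fun y hy => ?_, h.2⟩
  rw [State.reg_setReg, if_neg (by rintro rfl; exact hy hx)]
  exact h.1 y hy

theorem Frame.setArr {X A : List ℕ} {σ τ : State} (h : Frame X A σ τ) {k i v : ℕ} (hk : k ∈ A) :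
    Frame X A σ (τ.setArr k i v) := by
  refine ⟨h.1, fun l hl => ?_⟩
  rw [State.arr_setArr, if_neg (by rintro rfl; exact hl hk)]
  exact h.2 l hl

theorem Runs.frame {c : Prog} {σ τ : State} {t : ℕ} (h : Runs c σ τ t) :
    Frame c.regs c.arrs σ τ := by
  induction h with
  | skip σ => exact Frame.refl _ _ _
  | set σ x e => exact (Frame.refl _ _ _).setReg (by simp [Prog.regs])
  | store σ k i e => exact (Frame.refl _ _ _).setArr (by simp [Prog.arrs])
  | seq _ _ ih1 ih2 =>
    exact (ih1.mono (by simp [Prog.regs]) (by simp [Prog.arrs])).trans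
      (ih2.mono (by simp [Prog.regs]) (by simp [Prog.arrs]))
  | iteTrue _ _ ih => exact ih.mono (by simp [Prog.regs]) (by simp [Prog.arrs])
  | iteFalse _ _ ih => exact ih.mono (by simp [Prog.regs]) (by simp [Prog.arrs])
  | loopTrue _ _ _ ih1 ih2 => exact ih1.trans ih2
  | loopFalse => exact Frame.refl _ _ _

/-! ### Total-correctness rules with step counts -/

/-- Started in `σ`, the program `c` halts after at most `T` elementary steps in a state that
satisfies `Q`, and all values that are ever stored are at most `2 ^ E`. -/
def Spec (E : ℕ) (c : Prog) (σ : State) (T : ℕ) (Q : State → Prop) : Prop :=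
  0 < E → σ.Bdd E → ∃ (τ : State) (t : ℕ),
    Runs c σ τ t ∧ t ≤ T * (c.weight * (E + 2)) ∧ τ.Bdd E ∧ Q τ

/-- The frame is supplied for free here, so specifications need not list the registers and arrays
that a program leaves alone. -/
theorem Spec.imp {E : ℕ} {c : Prog} {σ : State} {T T' : ℕ} {Q Q' : State → Prop}
    (h : Spec E c σ T Q) (hT : T ≤ T')
    (hQ : ∀ τ, Frame c.regs c.arrs σ τ → Q τ → Q' τ) : Spec E c σ T' Q' := by
  intro hE hσ
  obtain ⟨τ, t, hr, ht, hb, hq⟩ := h hE hσ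
  exact ⟨τ, t, hr, ht.trans (Nat.mul_le_mul_right _ hT), hb, hQ τ hr.frame hq⟩

theorem Spec.skip {E : ℕ} {σ : State} {Q : State → Prop} (h : Q σ) : Spec E .skip σ 1 Q :=
  fun _ hσ => ⟨σ, 1, .skip σ, by simp only [Prog.weight]; omega, hσ, h⟩

theorem Spec.set {E : ℕ} {σ : State} {x : ℕ} {e : Expr} {Q : State → Prop}
    (hv : σ.Bdd E → e.eval σ ≤ 2 ^ E) (h : Q (σ.setReg x (e.eval σ))) :
    Spec E (.set x e) σ 1 Q := by
  intro hE hσ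
  refine ⟨_, _, .set σ x e, ?_, hσ.setReg (hv hσ), h⟩
  have := e.cost_le hE hσ
  simp only [Prog.weight]
  nlinarith

/-- Only the stored value needs a bound: the address is an expression over bounded data, so
`Expr.cost_le` controls its length. -/
theorem Spec.store {E : ℕ} {σ : State} {k : ℕ} {i e : Expr} {Q : State → Prop}
    (hv : σ.Bdd E → e.eval σ ≤ 2 ^ E) (h : Q (σ.setArr k (i.eval σ) (e.eval σ))) :
    Spec E (.store k i e) σ 1 Q := by
  intro hE hσ
  refine ⟨_, _, .store σ k i e, ?_, hσ.setArr (hv hσ), h⟩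
  have := e.cost_le hE hσ
  have := i.cost_le hE hσ
  simp only [Prog.weight]
  nlinarith

theorem Spec.seq {E : ℕ} {c d : Prog} {σ : State} {T U : ℕ} {Q : State → Prop}
    (h : Spec E c σ T fun τ => Spec E d τ U Q) : Spec E (.seq c d) σ (T + U) Q := by
  intro hE hσ
  obtain ⟨τ, t, hr, ht, hb, hq⟩ := h hE hσ
  obtain ⟨υ, u, hr', hu, hb', hq'⟩ := hq hE hb
  refine ⟨υ, _, .seq hr hr', ?_, hb', hq'⟩
  have h1 : t ≤ T * ((c.weight + d.weight) * (E + 2)) :=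
    ht.trans (Nat.mul_le_mul_left _ (Nat.mul_le_mul_right _ (by omega)))
  have h2 : u ≤ U * ((c.weight + d.weight) * (E + 2)) :=
    hu.trans (Nat.mul_le_mul_left _ (Nat.mul_le_mul_right _ (by omega)))
  simp only [Prog.weight, add_mul T U]
  omega

theorem Spec.ite {E : ℕ} {e : Expr} {c d : Prog} {σ : State} {T : ℕ} {Q : State → Prop}
    (h1 : e.eval σ ≠ 0 → Spec E c σ T Q) (h2 : e.eval σ = 0 → Spec E d σ T Q) :
    Spec E (.ite e c d) σ (T + 1) Q := by
  intro hE hσ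
  have hc := e.cost_le hE hσ
  have key : ∀ t w, t ≤ T * (w * (E + 2)) → w ≤ c.weight + d.weight →
      e.cost σ + t + 1 ≤ (T + 1) * ((e.weight + c.weight + d.weight + 1) * (E + 2)) := by
    intro t w ht hw
    have h1 : t ≤ T * ((e.weight + c.weight + d.weight + 1) * (E + 2)) :=
      ht.trans (Nat.mul_le_mul_left _ (Nat.mul_le_mul_right _ (by omega)))
    nlinarith
  by_cases h : e.eval σ = 0
  · obtain ⟨τ, t, hr, ht, hb, hq⟩ := h2 h hE hσ
    exact ⟨τ, _, .iteFalse h hr, key t _ ht (by omega), hb, hq⟩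
  · obtain ⟨τ, t, hr, ht, hb, hq⟩ := h1 h hE hσ
    exact ⟨τ, _, .iteTrue h hr, key t _ ht (by omega), hb, hq⟩

/-- The loop that runs `c` for `x = 0, …, N - 1`, where `N` is the value of `e`. -/
def Prog.forLoop (x : ℕ) (e : Expr) (c : Prog) : Prog :=
  .seq (.set x (.lit 0)) (.loop (e - .reg x) (.seq c (.set x (.reg x + .lit 1))))

/-- The truncated difference of bound and counter is nonzero exactly while iterations remain. The
bound is re-evaluated each time, so `he` asks that the body cannot change it. -/
theorem Spec.forLoop {E : ℕ} {x : ℕ} {e : Expr} {c : Prog} {σ : State} {Q : State → Prop}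
    (I : ℕ → State → Prop) (N T : ℕ) (hx : x ∉ c.regs)
    (he : ∀ τ, Frame (x :: c.regs) c.arrs σ τ → e.eval τ = N) (hN : N ≤ 2 ^ E)
    (h0 : I 0 (σ.setReg x 0))
    (hstep : ∀ i < N, ∀ τ, Frame (x :: c.regs) c.arrs σ τ → τ.reg x = i → I i τ →
      Spec E c τ T fun υ => I (i + 1) (υ.setReg x (i + 1)))
    (hQ : ∀ τ, Frame (x :: c.regs) c.arrs σ τ → τ.reg x = N → I N τ → Q τ) :
    Spec E (.forLoop x e c) σ (N * (T + 2) + 2) Q := by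
  have body : ∀ k i, i + k = N → ∀ τ, Frame (x :: c.regs) c.arrs σ τ → τ.reg x = i → I i τ →
      Spec E (.loop (e - .reg x) (.seq c (.set x (.reg x + .lit 1)))) τ (k * (T + 2) + 1) Q := by
    intro k
    induction k with
    | zero =>
      intro i hi τ hf hxi hI hE hτ
      obtain rfl : i = N := by omega
      refine ⟨τ, _, .loopFalse (by simp [he τ hf, hxi]), ?_, hτ, hQ τ hf hxi hI⟩
      have := (e - .reg x).cost_le hE hτ
      simp only [Prog.weight]
      nlinarith
    | succ k ih =>
      intro i hi τ hf hxi hI hE hτ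
      obtain ⟨υ, t, hr, ht, hb, hq⟩ := hstep i (by omega) τ hf hxi hI hE hτ
      have hfr := hr.frame
      have hxυ : υ.reg x = i := (hfr.1 x hx).trans hxi
      have hb' : (υ.setReg x (i + 1)).Bdd E := hb.setReg (by omega)
      have hset := Runs.set υ x (.reg x + .lit 1)
      simp only [Expr.eval_add, Expr.eval_reg, Expr.eval_lit, hxυ] at hset
      have hf' : Frame (x :: c.regs) c.arrs σ (υ.setReg x (i + 1)) :=
        (hf.trans (hfr.mono (by simp) (by simp))).setReg (by simp)
      obtain ⟨φ, u, hr', hu, hb'', hq'⟩ := ih (i + 1) (by omega) _ hf' (by simp) hq hE hb'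
      refine ⟨φ, _, .loopTrue (by simp [he τ hf, hxi]; omega) (.seq hr hset) hr', ?_, hb'', hq'⟩
      have h1 := (e - .reg x).cost_le hE hτ
      have h2 := (Expr.reg x + .lit 1).cost_le hE hb
      simp only [Prog.weight] at hu ⊢
      set a := (e - Expr.reg x).weight
      set b := (Expr.reg x + Expr.lit 1).weight
      set W := (a + (c.weight + (b + 1)) + 1) * (E + 2) with hW
      have h3 : t ≤ T * W := ht.trans (Nat.mul_le_mul_left _ (Nat.mul_le_mul_right _ (by omega)))
      have h4 : a * (E + 2) + b * (E + 2) + 2 ≤ W := by rw [hW]; nlinarith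
      have h5 : ((k + 1) * (T + 2) + 1) * W = (k * (T + 2) + 1) * W + T * W + 2 * W := by ring
      rw [h5]
      omega
  have h := Spec.seq (E := E) (c := .set x (.lit 0)) (σ := σ) (T := 1)
    (Spec.set (by simp) (body N 0 (by omega) _ ((Frame.refl _ _ _).setReg (by simp)) (by simp) h0))
  exact h.imp (by omega) fun _ _ h => h

/-- A loop that writes the values `f 0, …, f (N - 1)` to the cells `0, …, N - 1` of the
array `A`. -/
theorem Spec.fill {E : ℕ} {x A : ℕ} {e v : Expr} {σ : State} {Q : State → Prop}
    (f : ℕ → ℕ) (N : ℕ)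
    (he : ∀ τ, Frame [x] [A] σ τ → e.eval τ = N) (hN : N ≤ 2 ^ E)
    (hf : ∀ k < N, f k ≤ 2 ^ E)
    (hv : ∀ k < N, ∀ τ, Frame [x] [A] σ τ → τ.reg x = k →
      (∀ c, k ≤ c → τ.arr A c = σ.arr A c) → v.eval τ = f k)
    (hQ : ∀ τ, Frame [x] [A] σ τ →
      (∀ c, τ.arr A c = if c < N then f c else σ.arr A c) → Q τ) :
    Spec E (.forLoop x e (.store A (.reg x) v)) σ (3 * N + 2) Q := by
  refine (Spec.forLoop (c := .store A (.reg x) v)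
    (fun k τ => ∀ c, τ.arr A c = if c < k then f c else σ.arr A c) N 1 (by simp [Prog.regs]) he hN
    (by simp) ?_ fun τ h _ h' => hQ τ h h').imp (by omega) fun _ _ h => h
  intro k hk τ hfr hx hI
  have hval : v.eval τ = f k := hv k hk τ hfr hx fun c hc => by rw [hI, if_neg (by omega)]
  refine Spec.store (fun _ => hval ▸ hf k hk) fun c => ?_
  simp only [Expr.eval_reg, hx, hval, State.arr_setReg, State.arr_setArr, if_true,
    Function.update_apply, hI]
  split_ifs <;> first | omega | simp_all

end RAM

/-! ### Generating the `s`-subsets of `{0, …, n - 1}` as bit masks -/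

/-- The number whose binary digits form the indicator function of `A`. -/
def bitMask (A : Finset ℕ) : ℕ := ∑ i ∈ A, 2 ^ i

theorem bitMask_div_mod (A : Finset ℕ) (v : ℕ) :
    bitMask A / 2 ^ v % 2 = if v ∈ A then 1 else 0 := by
  have h : (bitMask A).testBit v = true ↔ v ∈ A := by
    rw [← Nat.mem_bitIndices, ← List.mem_toFinset, bitMask, Finset.toFinset_bitIndices_sum_two_pow]
  rw [Nat.testBit_eq_decide_div_mod_eq, decide_eq_true_iff] at h
  split_ifs with hv
  · exact h.2 hv
  · have := mt h.1 hv
    omega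

theorem bitMask_insert {A : Finset ℕ} {x : ℕ} (hx : x ∉ A) :
    bitMask (insert x A) = bitMask A + 2 ^ x := by
  rw [bitMask, Finset.sum_insert hx, add_comm, bitMask]

theorem bitMask_lt {A : Finset ℕ} {x : ℕ} (h : A ⊆ Finset.range x) : bitMask A < 2 ^ x :=
  Nat.geomSum_lt le_rfl fun _ hi => Finset.mem_range.1 (h hi)

/-- The list `S 0, …, S (N - 1)` consists of the masks of sets with `K i` elements; the set with
index `i` is the trace on `{0, …, lev i - 1}` of an `s`-subset of `{0, …, n - 1}`, and each
`s`-subset has such a trace in the list. -/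
structure PartialSubsets (n s : ℕ) (lev : ℕ → ℕ) (N : ℕ) (S K : ℕ → ℕ) : Prop where
  exists_set : ∀ i < N, ∃ A ⊆ Finset.range (lev i), A.card = K i ∧ S i = bitMask A
  le : ∀ i < N, K i ≤ s
  le_add : ∀ i < N, s + lev i ≤ K i + n
  cover : ∀ T ⊆ Finset.range n, T.card = s → ∃ i < N,
    S i = bitMask (T ∩ Finset.range (lev i)) ∧ K i = (T ∩ Finset.range (lev i)).card
  sum_choose : ∑ i ∈ Finset.range N, (n - lev i).choose (s - K i) = n.choose s

namespace PartialSubsets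

variable {n s N : ℕ} {lev S K : ℕ → ℕ}

theorem congr {lev' S' K' : ℕ → ℕ} (h : PartialSubsets n s lev N S K)
    (hl : ∀ i < N, lev' i = lev i) (hS : ∀ i < N, S' i = S i) (hK : ∀ i < N, K' i = K i) :
    PartialSubsets n s lev' N S' K' where
  exists_set i hi := by rw [hl i hi, hS i hi, hK i hi]; exact h.exists_set i hi
  le i hi := hK i hi ▸ h.le i hi
  le_add i hi := by rw [hl i hi, hK i hi]; exact h.le_add i hi
  cover T hT hs := by
    obtain ⟨i, hi, h'⟩ := h.cover T hT hs
    exact ⟨i, hi, by rwa [hl i hi, hS i hi, hK i hi]⟩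
  sum_choose := by
    rw [← h.sum_choose]
    refine Finset.sum_congr rfl fun i hi => ?_
    rw [Finset.mem_range] at hi
    rw [hl i hi, hK i hi]

theorem start (hs : s ≤ n) {S K : ℕ → ℕ} (hS : S 0 = 0) (hK : K 0 = 0) :
    PartialSubsets n s (fun _ => 0) 1 S K where
  exists_set i hi := by
    obtain rfl : i = 0 := by omega
    exact ⟨∅, by simp, by simp [hK], by simp [hS, bitMask]⟩
  le i hi := by
    obtain rfl : i = 0 := by omega
    omega
  le_add i hi := by
    obtain rfl : i = 0 := by omega
    simpa [hK] using hs
  cover T _ _ := ⟨0, by omega, by simp [hS, bitMask], by simp [hK]⟩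
  sum_choose := by simp [hK]

/-- Each summand of `sum_choose` counts the extensions of one partial subset to an `s`-set, and
`le_add` makes it positive. This keeps the enumeration within the allowed time. -/
theorem le_choose (h : PartialSubsets n s lev N S K) : N ≤ n.choose s := by
  rw [← h.sum_choose]
  calc N = ∑ i ∈ Finset.range N, 1 := by simp
    _ ≤ _ := Finset.sum_le_sum fun i hi => Nat.choose_pos (by
      rw [Finset.mem_range] at hi
      have := h.le_add i hi
      omega)

theorem lt_two_pow (h : PartialSubsets n s lev N S K) {i : ℕ} (hi : i < N) :
    S i < 2 ^ lev i := by
  obtain ⟨A, hA, -, hS⟩ := h.exists_set i hi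
  exact hS ▸ bitMask_lt hA

theorem inter_range_succ_of_mem {T : Finset ℕ} {x : ℕ} (hx : x ∈ T) :
    T ∩ Finset.range (x + 1) = insert x (T ∩ Finset.range x) := by
  ext y
  simp only [Finset.mem_inter, Finset.mem_range, Finset.mem_insert]
  constructor
  · rintro ⟨h1, h2⟩
    by_cases h : y = x
    · exact .inl h
    · exact .inr ⟨h1, by omega⟩
  · rintro (rfl | ⟨h1, h2⟩)
    · exact ⟨hx, by omega⟩
    · exact ⟨h1, by omega⟩

theorem inter_range_succ_of_notMem {T : Finset ℕ} {x : ℕ} (hx : x ∉ T) :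
    T ∩ Finset.range (x + 1) = T ∩ Finset.range x := by
  ext y
  simp only [Finset.mem_inter, Finset.mem_range]
  refine and_congr_right fun hy => ?_
  have : y ≠ x := by rintro rfl; exact hx hy
  omega

theorem card_le_card_inter_add {T : Finset ℕ} (hT : T ⊆ Finset.range n) (x : ℕ) :
    T.card ≤ (T ∩ Finset.range x).card + (n - x) := by
  have h : T ⊆ (T ∩ Finset.range x) ∪ Finset.Ico x n := by
    intro y hy
    have := Finset.mem_range.1 (hT hy)
    simp only [Finset.mem_union, Finset.mem_inter, Finset.mem_range, Finset.mem_Ico]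
    by_cases hyx : y < x
    · exact .inl ⟨hy, hyx⟩
    · exact .inr ⟨by omega, this⟩
  simpa using (Finset.card_le_card h).trans (Finset.card_union_le _ _)

theorem sum_update {f g : ℕ → ℕ} {j : ℕ} (hj : j < N) (h : ∀ i < N, i ≠ j → g i = f i) :
    ∑ i ∈ Finset.range N, g i + f j = ∑ i ∈ Finset.range N, f i + g j := by
  have hj' := Finset.mem_range.2 hj
  rw [← Finset.add_sum_erase _ g hj', ← Finset.add_sum_erase _ f hj',
    Finset.sum_congr rfl fun i hi => h i (Finset.mem_range.1 (Finset.mem_of_mem_erase hi))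
      (Finset.ne_of_mem_erase hi)]
  ring

/-- A full trace cannot take another element; its only extension is itself, before and after the
step. -/
theorem skip (h : PartialSubsets n s lev N S K) {j : ℕ} (hj : j < N) (hx : lev j < n)
    (hK : K j = s) : PartialSubsets n s (Function.update lev j (lev j + 1)) N S K where
  exists_set i hi := by
    obtain ⟨A, hA, h'⟩ := h.exists_set i hi
    refine ⟨A, hA.trans (Finset.range_mono ?_), h'⟩
    rw [Function.update_apply]; split_ifs with hij
    · subst hij; omega
    · exact le_rfl
  le := h.le
  le_add i hi := by
    have := h.le_add i hi
    rw [Function.update_apply]; split_ifs with hij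
    · subst hij; omega
    · exact this
  cover T hT hs := by
    obtain ⟨i, hi, hS, hc⟩ := h.cover T hT hs
    refine ⟨i, hi, ?_⟩
    rw [Function.update_apply]
    split_ifs with hij
    · subst hij
      have hxT : lev i ∉ T := by
        intro hmem
        have h1 : insert (lev i) (T ∩ Finset.range (lev i)) ⊆ T :=
          Finset.insert_subset hmem Finset.inter_subset_left
        have h2 := Finset.card_le_card h1
        rw [Finset.card_insert_of_notMem (by simp)] at h2
        omega
      rw [inter_range_succ_of_notMem hxT]
      exact ⟨hS, hc⟩
    · exact ⟨hS, hc⟩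
  sum_choose := by
    have := sum_update (f := fun i => (n - lev i).choose (s - K i))
      (g := fun i => (n - Function.update lev j (lev j + 1) i).choose (s - K i)) hj
      fun i _ hij => by simp [hij]
    simp only [Function.update_self, hK, Nat.sub_self, Nat.choose_zero_right] at this
    rw [← h.sum_choose]
    omega

/-- With `le_add`, `hlast` says that exactly as many elements remain as are missing. All of them are
forced, and the number of extensions stays 1. -/
theorem take (h : PartialSubsets n s lev N S K) {j : ℕ} (hj : j < N) (hx : lev j < n)
    (hK : K j < s) (hlast : n + K j ≤ s + lev j) :
    PartialSubsets n s (Function.update lev j (lev j + 1)) N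
      (Function.update S j (S j + 2 ^ lev j)) (Function.update K j (K j + 1)) where
  exists_set i hi := by
    obtain ⟨A, hA, hc, hS⟩ := h.exists_set i hi
    by_cases hij : i = j
    · subst hij
      have hxA : lev i ∉ A := fun hmem => by simpa using hA hmem
      refine ⟨insert (lev i) A, ?_, ?_, ?_⟩
      · rw [Function.update_self, Finset.range_add_one]
        exact Finset.insert_subset_insert _ hA
      · simp [Finset.card_insert_of_notMem hxA, hc]
      · simp [bitMask_insert hxA, hS]
    · simpa [hij] using ⟨A, hA, hc, hS⟩
  le i hi := by
    have := h.le i hi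
    rw [Function.update_apply]; split_ifs <;> omega
  le_add i hi := by
    have := h.le_add i hi
    simp only [Function.update_apply]; split_ifs with hij
    · subst hij; omega
    · exact this
  cover T hT hs := by
    obtain ⟨i, hi, hS, hc⟩ := h.cover T hT hs
    refine ⟨i, hi, ?_⟩
    by_cases hij : i = j
    · subst hij
      have hxT : lev i ∈ T := by
        by_contra hmem
        have := card_le_card_inter_add hT (lev i + 1)
        rw [inter_range_succ_of_notMem hmem] at this
        omega
      simp only [Function.update_self, inter_range_succ_of_mem hxT]
      rw [bitMask_insert (by simp), Finset.card_insert_of_notMem (by simp)]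
      omega
    · simpa [hij] using ⟨hS, hc⟩
  sum_choose := by
    have := sum_update (f := fun i => (n - lev i).choose (s - K i))
      (g := fun i => (n - Function.update lev j (lev j + 1) i).choose
        (s - Function.update K j (K j + 1) i)) hj
      fun i _ hij => by simp [hij]
    have h1 := h.le_add j hj
    simp only [Function.update_self, show n - lev j = s - K j by omega,
      show n - (lev j + 1) = s - (K j + 1) by omega, Nat.choose_self] at this
    rw [← h.sum_choose]
    omega

/-- Both choices can be completed: entry `j` becomes the one without the new element, and the one
with it is appended at `N`. Pascal's rule splits the number of extensions accordingly. -/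
theorem branch (h : PartialSubsets n s lev N S K) {j : ℕ} (hj : j < N)
    (hK : K j < s) (hlast : s + lev j < n + K j) :
    PartialSubsets n s (Function.update (Function.update lev j (lev j + 1)) N (lev j + 1)) (N + 1)
      (Function.update S N (S j + 2 ^ lev j)) (Function.update K N (K j + 1)) where
  exists_set i hi := by
    by_cases hiN : i = N
    · subst hiN
      obtain ⟨A, hA, hc, hS⟩ := h.exists_set j hj
      have hxA : lev j ∉ A := fun hmem => by simpa using hA hmem
      refine ⟨insert (lev j) A, ?_, ?_, ?_⟩
      · rw [Function.update_self, Finset.range_add_one]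
        exact Finset.insert_subset_insert _ hA
      · simp [Finset.card_insert_of_notMem hxA, hc]
      · simp [bitMask_insert hxA, hS]
    · obtain ⟨A, hA, hc, hS⟩ := h.exists_set i (by omega)
      refine ⟨A, hA.trans (Finset.range_mono ?_), by simpa [hiN], by simpa [hiN]⟩
      rw [Function.update_of_ne hiN, Function.update_apply]
      split_ifs with hij
      · subst hij; omega
      · exact le_rfl
  le i hi := by
    by_cases hiN : i = N
    · subst hiN; simp; omega
    · simpa [hiN] using h.le i (by omega)
  le_add i hi := by
    by_cases hiN : i = N
    · subst hiN; simp; omega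
    · have := h.le_add i (by omega)
      by_cases hij : i = j
      · subst hij; simp [hiN]; omega
      · simpa [hij, hiN]
  cover T hT hs := by
    obtain ⟨i, hi, hS, hc⟩ := h.cover T hT hs
    by_cases hij : i = j
    · subst hij
      by_cases hxT : lev i ∈ T
      · refine ⟨N, by omega, ?_⟩
        simp only [Function.update_self, inter_range_succ_of_mem hxT]
        rw [bitMask_insert (by simp), Finset.card_insert_of_notMem (by simp)]
        omega
      · refine ⟨i, by omega, ?_⟩
        simp only [Function.update_of_ne hi.ne, Function.update_self,
          inter_range_succ_of_notMem hxT]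
        exact ⟨hS, hc⟩
    · refine ⟨i, by omega, ?_⟩
      simp only [Function.update_of_ne hi.ne, Function.update_of_ne hij]
      exact ⟨hS, hc⟩
  sum_choose := by
    have := sum_update (f := fun i => (n - lev i).choose (s - K i))
      (g := fun i => (n - Function.update lev j (lev j + 1) i).choose (s - K i)) hj
      fun i _ hij => by simp [hij]
    simp only [Function.update_self] at this
    rw [Finset.sum_range_succ, ← h.sum_choose]
    simp only [Function.update_self]
    have h2 : ∑ i ∈ Finset.range N,
        (n - Function.update (Function.update lev j (lev j + 1)) N (lev j + 1) i).choose
          (s - Function.update K N (K j + 1) i) =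
        ∑ i ∈ Finset.range N, (n - Function.update lev j (lev j + 1) i).choose (s - K i) := by
      refine Finset.sum_congr rfl fun i hi => ?_
      have hiN : i ≠ N := (Finset.mem_range.1 hi).ne
      simp only [Function.update_of_ne hiN]
    have h3 := Nat.choose_succ_succ (n - (lev j + 1)) (s - (K j + 1))
    simp only [Nat.succ_eq_add_one, show n - (lev j + 1) + 1 = n - lev j by omega,
      show s - (K j + 1) + 1 = s - K j by omega] at h3
    rw [h2]
    omega

end PartialSubsets

/-! ### Elimination -/

/-- Column `j` of the matrix whose columns, of length `R`, are listed one after the other in `M`. -/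
def flatColumn (p R : ℕ) (M : ℕ → ℕ) (j i : ℕ) : ZMod p := (M (j * R + i) : ZMod p)

/-- Column `j₀` is a linear combination of the first `C` columns. -/
def FlatSolvable (p R C : ℕ) (M : ℕ → ℕ) (j₀ : ℕ) : Prop :=
  ∃ c : ℕ → ZMod p, ∀ i < R,
    flatColumn p R M j₀ i = ∑ j ∈ Finset.range C, c j * flatColumn p R M j i

/-- Subtract from all columns the multiples of the column of the pivot `q` that make the row of the
pivot vanish, after scaling with the pivot. -/
def eliminate (p R : ℕ) (M : ℕ → ℕ) (q k : ℕ) : ℕ :=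
  (M q * M k + (p - M (k / R * R + q % R)) * M (q / R * R + k % R)) % p

theorem mul_add_div_mod {R i : ℕ} (j : ℕ) (hi : i < R) :
    (j * R + i) / R = j ∧ (j * R + i) % R = i := by
  constructor
  · rw [add_comm, Nat.add_mul_div_right _ _ (by omega), Nat.div_eq_of_lt hi, zero_add]
  · rw [add_comm, Nat.add_mul_mod_self_right, Nat.mod_eq_of_lt hi]

theorem mul_add_lt {R C i j : ℕ} (hj : j < C) (hi : i < R) : j * R + i < C * R := by
  calc j * R + i < (j + 1) * R := by rw [add_mul]; omega
    _ ≤ C * R := Nat.mul_le_mul_right _ hj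

theorem flatColumn_eliminate {p R N : ℕ} {M M' : ℕ → ℕ} {q : ℕ}
    (hM : ∀ k < N * R, M k < p) (hM' : ∀ k < N * R, M' k = eliminate p R M q k) {i j : ℕ}
    (hi : i < R) (hj : j < N) :
    flatColumn p R M' j i = flatColumn p R M (q / R) (q % R) * flatColumn p R M j i -
      flatColumn p R M j (q % R) * flatColumn p R M (q / R) i := by
  have hR : 0 < R := by omega
  obtain ⟨h1, h2⟩ := mul_add_div_mod j hi
  have h3 : q / R * R + q % R = q := Nat.div_add_mod' q R
  have h4 := (hM _ (mul_add_lt hj (Nat.mod_lt q hR))).le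
  simp only [flatColumn, hM' _ (mul_add_lt hj hi), eliminate, h1, h2, h3, ZMod.natCast_mod,
    Nat.cast_add, Nat.cast_mul, Nat.cast_sub h4, ZMod.natCast_self]
  ring

/-- With pivot column `u` and pivot row `e`, every column `v` becomes `u e • v - v e • u`. This map
is linear, so it preserves linear relations; its kernel is spanned by `u`, which is one of the first
`C` columns, so relations also lift back. -/
theorem flatSolvable_eliminate {p R N C : ℕ} [Fact p.Prime] {M M' : ℕ → ℕ} {q : ℕ}
    (hCN : C ≤ N) (hq : q < C * R) (hM : ∀ k < N * R, M k < p)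
    (hM' : ∀ k < N * R, M' k = eliminate p R M q k) (hne : M q ≠ 0) {j₀ : ℕ} (hj₀ : j₀ < N) :
    FlatSolvable p R C M' j₀ ↔ FlatSolvable p R C M j₀ := by
  have hR : 0 < R := Nat.pos_of_ne_zero (by rintro rfl; simp at hq)
  have hqN : q < N * R := hq.trans_le (Nat.mul_le_mul_right _ hCN)
  have hqC : q / R < C := Nat.div_lt_of_lt_mul (by rwa [mul_comm])
  have key := fun {i j : ℕ} => flatColumn_eliminate (i := i) (j := j) hM hM'
  set u := flatColumn p R M (q / R) with hu
  set e := q % R with he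
  have heR : e < R := Nat.mod_lt q hR
  have hue : u e ≠ 0 := by
    rw [hu, flatColumn, he, Nat.div_add_mod' q R, Ne, ZMod.natCast_eq_zero_iff]
    exact fun hd => hne (Nat.eq_zero_of_dvd_of_lt hd (hM q hqN))
  constructor
  · rintro ⟨c, hc⟩
    -- The defect of the old relation is a multiple of `u`; its entry `a` in the pivot row
    -- determines the correction `(u e)⁻¹ * a` to the coefficient of the pivot column.
    let a := flatColumn p R M j₀ e - ∑ j ∈ Finset.range C, c j * flatColumn p R M j e
    refine ⟨fun j => c j + if j = q / R then (u e)⁻¹ * a else 0, fun i hi => ?_⟩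
    have h1 := hc i hi
    rw [key hi hj₀, Finset.sum_congr rfl fun j hj => by
      rw [key hi ((Finset.mem_range.1 hj).trans_le hCN)]] at h1
    simp only [mul_sub, Finset.sum_sub_distrib] at h1
    have h2 : ∑ j ∈ Finset.range C, c j * (u e * flatColumn p R M j i) =
        u e * ∑ j ∈ Finset.range C, c j * flatColumn p R M j i := by
      rw [Finset.mul_sum]; exact Finset.sum_congr rfl fun _ _ => by ring
    have h3 : ∑ j ∈ Finset.range C, c j * (flatColumn p R M j e * u i) =
        (∑ j ∈ Finset.range C, c j * flatColumn p R M j e) * u i := by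
      rw [Finset.sum_mul]; exact Finset.sum_congr rfl fun _ _ => by ring
    rw [h2, h3] at h1
    simp only [add_mul, Finset.sum_add_distrib, ite_mul, zero_mul, Finset.sum_ite_eq',
      Finset.mem_range, hqC, if_true]
    apply mul_left_cancel₀ hue
    rw [← hu, mul_add, ← mul_assoc, ← mul_assoc, mul_inv_cancel₀ hue, one_mul]
    linear_combination h1
  · rintro ⟨c, hc⟩
    refine ⟨c, fun i hi => ?_⟩
    rw [key hi hj₀, hc i hi, hc e heR, Finset.mul_sum, Finset.sum_mul, ← Finset.sum_sub_distrib]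
    refine Finset.sum_congr rfl fun j hj => ?_
    rw [key hi ((Finset.mem_range.1 hj).trans_le hCN)]
    ring

/-- In earlier columns both products contain an entry that is already zero. In the pivot's own
column the two products add up to a multiple of `p`, so that whole column is cleared. Scanning
pivots in order thus enlarges an initial segment of zeros. -/
theorem eliminate_eq_zero {p R N : ℕ} {M : ℕ → ℕ} {q : ℕ} (hR : 0 < R) (hq : q < N * R)
    (hM : ∀ k < N * R, M k < p) (h0 : ∀ k < q, M k = 0) {k : ℕ} (hk : k ≤ q) :
    eliminate p R M q k = 0 := by
  unfold eliminate
  have h1 : k / R ≤ q / R := Nat.div_le_div_right hk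
  have h3 := Nat.div_add_mod' q R
  rcases h1.lt_or_eq with hlt | heq
  · have h2 : k / R * R + q % R < q := by
      have : (k / R + 1) * R ≤ q / R * R := Nat.mul_le_mul_right _ hlt
      have := Nat.mod_lt q hR
      rw [add_mul] at *
      omega
    have hkq : k < q := by
      rcases hk.lt_or_eq with h | h
      · exact h
      · subst h; omega
    simp [h0 k hkq, h0 _ h2]
  · have h4 := Nat.div_add_mod' k R
    rw [← heq, heq, h3, ← heq, h4, ← add_mul, show M q + (p - M q) = p by have := hM q hq; omega]
    simp

/-! ### The decision program -/

namespace RAM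

section Program

open RAM.Expr

/-- Read the header of the input: afterwards the registers `1, …, 6` hold `p, m, n, s, r` and the
number of hyperedges. -/
def parseHeader : Prog :=
  .seq (.set 1 (arr 0 (lit 0))) <| .seq (.set 2 (arr 0 (lit 1))) <|
  .seq (.set 3 (arr 0 (lit 2))) <| .seq (.set 4 (arr 0 (lit 3))) <|
  .seq (.set 5 (arr 0 (lit 4))) <| .set 6 ((reg 0 - lit 5) / (reg 5 + reg 2))

/-- Decide for the partial subset with index `reg 9` whether it contains `reg 8`; if both are
possible, both possibilities are kept. -/
def splitSubset : Prog :=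
  .ite (reg 4 - arr 3 (reg 9))
    (.ite ((reg 3 + arr 3 (reg 9)) - (reg 4 + reg 8))
      (.seq (.store 2 (reg 7) (arr 2 (reg 9) + reg 11))
        (.seq (.store 3 (reg 7) (arr 3 (reg 9) + lit 1)) (.set 7 (reg 7 + lit 1))))
      (.seq (.store 2 (reg 9) (arr 2 (reg 9) + reg 11))
        (.store 3 (reg 9) (arr 3 (reg 9) + lit 1))))
    .skip

/-- Write the masks of all `s`-subsets to array `2`, their number to register `7`, and the powers
of two to array `1`. -/
def listSubsets : Prog :=
  .seq (.set 7 (lit 1)) <| .seq (.set 11 (lit 1)) <|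
  .forLoop 8 (reg 3) <|
    .seq (.store 1 (reg 8) (reg 11)) <| .seq (.set 10 (reg 7)) <|
    .seq (.forLoop 9 (reg 10) splitSubset) <| .set 11 (reg 11 * lit 2)

/-- Write the numbers of common elements of the `s`-subsets and the hyperedges to array `4`. -/
def countCommon : Prog :=
  .forLoop 14 (reg 5) <| .forLoop 12 (reg 7 * reg 6) <| .store 4 (reg 12) <|
    arr 4 (reg 12) + (arr 2 (reg 12 / reg 6) /
      arr 1 (arr 0 ((lit 5 + reg 12 % reg 6 * (reg 5 + reg 2)) + reg 14))) % lit 2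

/-- Write the columns of the inclusion matrix and the coordinates of the colouring to array `5`. -/
def writeMatrix : Prog :=
  .seq (.forLoop 12 ((reg 7 + reg 2) * reg 6) <| .store 5 (reg 12) <|
    arr 0 ((lit 5 + reg 12 % reg 6 * (reg 5 + reg 2)) + (reg 5 + (reg 12 / reg 6 - reg 7)))) <|
  .forLoop 12 (reg 7 * reg 6) <| .store 5 (reg 12) (lit 1 - (reg 4 - arr 4 (reg 12)))

/-- Eliminate with the pivot `reg 13`. -/
def pivotStep : Prog :=
  .seq (.forLoop 12 (reg 6) <| .store 6 (reg 12) (arr 5 (reg 13 / reg 6 * reg 6 + reg 12))) <|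
  .seq (.forLoop 12 (reg 7 + reg 2) <|
    .store 7 (reg 12) (arr 5 (reg 12 * reg 6 + reg 13 % reg 6))) <|
  .seq (.set 11 (arr 5 (reg 13))) <|
  .forLoop 12 ((reg 7 + reg 2) * reg 6) <| .store 5 (reg 12) <|
    (reg 11 * arr 5 (reg 12) + (reg 1 - arr 7 (reg 12 / reg 6)) * arr 6 (reg 12 % reg 6)) % reg 1

/-- Eliminate with all nonzero pivots. -/
def eliminateAll : Prog :=
  .forLoop 13 (reg 7 * reg 6) <| .ite (arr 5 (reg 13)) pivotStep .skip

/-- Write `1` to register `0` if the matrix is zero, and `0` otherwise. -/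
def checkZero : Prog :=
  .seq (.set 0 (lit 1)) <|
  .forLoop 12 ((reg 7 + reg 2) * reg 6) <| .set 0 (reg 0 * (lit 1 - arr 5 (reg 12)))

/-- The decision algorithm for the image of the lifting map. -/
def decideImage : Prog :=
  .seq parseHeader <| .seq listSubsets <| .seq countCommon <| .seq writeMatrix <|
  .seq eliminateAll checkZero

end Program

/-! ### Correctness and step counts of the subprograms -/

theorem Spec.of_bdd {E : ℕ} {c : Prog} {σ : State} {T : ℕ} {Q : State → Prop}
    (h : σ.Bdd E → Spec E c σ T Q) : Spec E c σ T Q :=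
  fun hE hσ => h hσ hE hσ

theorem parseHeader_spec {E : ℕ} {σ : State}
    (hlen : (σ.reg 0 - 5) / (σ.arr 0 4 + σ.arr 0 1) ≤ 2 ^ E) :
    Spec E parseHeader σ 6 fun τ => τ.arr = σ.arr ∧ τ.reg 1 = σ.arr 0 0 ∧ τ.reg 2 = σ.arr 0 1 ∧
      τ.reg 3 = σ.arr 0 2 ∧ τ.reg 4 = σ.arr 0 3 ∧ τ.reg 5 = σ.arr 0 4 ∧
      τ.reg 6 = (σ.reg 0 - 5) / (σ.arr 0 4 + σ.arr 0 1) := by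
  have load : ∀ {x i : ℕ} {τ : State} {Q : State → Prop},
      Q (τ.setReg x (τ.arr 0 i)) → Spec E (.set x (.arr 0 (.lit i))) τ 1 Q :=
    fun h => Spec.set (fun hb => hb.2 _ _) h
  refine Spec.imp (T := 1 + (1 + (1 + (1 + (1 + 1))))) ?_ le_rfl fun _ _ h => h
  refine Spec.seq <| load <| Spec.seq <| load <| Spec.seq <| load <| Spec.seq <| load <|
    Spec.seq <| load <| Spec.set (fun _ => ?_) ?_
  · simpa using hlen
  · simp only [Expr.eval_div, Expr.eval_sub, Expr.eval_reg, Expr.eval_add, Expr.eval_lit,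
      State.reg_setReg, State.arr_setReg]
    simp
    rfl

/-- Here `N` is the list length at the start of the pass for element `x`. Entries before `j` are
processed and entries from `N` on were appended during the pass, so both have level `x + 1`; the
pass stops at `N` and does not revisit appended entries. -/
theorem splitSubset_spec {E n s x j N : ℕ} {σ : State} (h3 : σ.reg 3 = n) (h4 : σ.reg 4 = s)
    (h8 : σ.reg 8 = x) (h9 : σ.reg 9 = j) (h11 : σ.reg 11 = 2 ^ x) (hx : x < n) (hj : j < N)
    (hn : n ≤ E) (hs : s ≤ 2 ^ E) (hC : n.choose s ≤ 2 ^ E) (hN : N ≤ σ.reg 7)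
    (h : PartialSubsets n s (fun i => if i < j ∨ N ≤ i then x + 1 else x) (σ.reg 7) (σ.arr 2)
      (σ.arr 3)) :
    Spec E splitSubset σ 5 fun τ => N ≤ τ.reg 7 ∧
      PartialSubsets n s (fun i => if i < j + 1 ∨ N ≤ i then x + 1 else x) (τ.reg 7) (τ.arr 2)
        (τ.arr 3) := by
  have hj7 : j < σ.reg 7 := by omega
  have hlev : (if j < j ∨ N ≤ j then x + 1 else x) = x := if_neg (by omega)
  have hKs := h.le j hj7
  have hlev' : ∀ i, (if i < j + 1 ∨ N ≤ i then x + 1 else x) =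
      Function.update (fun i => if i < j ∨ N ≤ i then x + 1 else x) j (x + 1) i := by
    intro i
    rw [Function.update_apply]
    split_ifs <;> omega
  have hpow : ∀ {a}, a < 2 ^ (x + 1) → a ≤ 2 ^ E := fun ha =>
    ha.le.trans (Nat.pow_le_pow_right (by norm_num) (by omega))
  refine Spec.ite (T := 4) (fun hne => ?_) fun heq => ?_
  · simp only [Expr.eval_sub, Expr.eval_reg, Expr.eval_arr, h4, h9] at hne
    refine Spec.ite (T := 3) (fun hne' => ?_) fun heq' => ?_
    · simp only [Expr.eval_sub, Expr.eval_add, Expr.eval_reg, Expr.eval_arr, h3, h4, h8, h9] at hne'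
      have hb := h.branch hj7 (by omega) (by simp only [hlev]; omega)
      simp only [hlev] at hb
      have hlt := hb.lt_two_pow (Nat.lt_succ_self _)
      simp only [Function.update_self] at hlt
      refine Spec.seq (T := 1) (U := 2) <| Spec.store (fun _ => by simpa [h9, h11] using hpow hlt) <|
        Spec.seq (T := 1) (U := 1) <| Spec.store (fun _ => by simp [h9]; omega) <|
        Spec.set (fun _ => by simpa using hb.le_choose.trans hC) ?_
      simp only [Expr.eval_reg, Expr.eval_add, Expr.eval_arr, Expr.eval_lit, h9, h11,
        State.reg_setArr, State.arr_setArr, State.reg_setReg, State.arr_setReg, if_true,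
        show (2 : ℕ) ≠ 3 by decide, show (3 : ℕ) ≠ 2 by decide, if_false]
      refine ⟨by omega, hb.congr (fun i hi => ?_) (fun _ _ => rfl) fun _ _ => rfl⟩
      rw [hlev' i]
      by_cases hi7 : i = σ.reg 7
      · subst hi7
        rw [Function.update_self, Function.update_of_ne (by omega), if_pos (.inr hN)]
      · rw [Function.update_of_ne hi7]
    · simp only [Expr.eval_sub, Expr.eval_add, Expr.eval_reg, Expr.eval_arr, h3, h4, h8, h9] at heq'
      have hb := h.take hj7 (by simpa only [hlev]) (by omega) (by simp only [hlev]; omega)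
      simp only [hlev] at hb
      have hlt := hb.lt_two_pow hj7
      simp only [Function.update_self] at hlt
      refine (Spec.seq (T := 1) (U := 1) <|
        Spec.store (fun _ => by simpa [h9, h11] using hpow hlt) <|
        Spec.store (fun _ => by simp [h9]; omega) ?_).imp (by omega) fun _ _ h => h
      simp only [Expr.eval_reg, Expr.eval_add, Expr.eval_arr, Expr.eval_lit, h9, h11,
        State.reg_setArr, State.arr_setArr, if_true,
        show (2 : ℕ) ≠ 3 by decide, show (3 : ℕ) ≠ 2 by decide, if_false]
      exact ⟨hN, hb.congr (fun i _ => hlev' i) (fun _ _ => rfl) fun _ _ => rfl⟩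
  · simp only [Expr.eval_sub, Expr.eval_reg, Expr.eval_arr, h4, h9] at heq
    refine (Spec.skip ?_).imp (by omega) fun _ _ h => h
    have hb := h.skip hj7 (by simpa only [hlev]) (by omega)
    simp only [hlev] at hb
    exact ⟨hN, hb.congr (fun i _ => hlev' i) (fun _ _ => rfl) fun _ _ => rfl⟩

theorem listSubsets_spec {E n s : ℕ} {σ : State} (h3 : σ.reg 3 = n) (h4 : σ.reg 4 = s)
    (hS : σ.arr 2 0 = 0) (hK : σ.arr 3 0 = 0) (hsn : s ≤ n) (hn : n ≤ E)
    (hC : n.choose s ≤ 2 ^ E) :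
    Spec E listSubsets σ (n * (7 * n.choose s + 7) + 4) fun τ =>
      PartialSubsets n s (fun _ => n) (τ.reg 7) (τ.arr 2) (τ.arr 3) ∧
      ∀ y < n, τ.arr 1 y = 2 ^ y := by
  have hnE : n ≤ 2 ^ E := hn.trans Nat.lt_two_pow_self.le
  have h1E : 1 ≤ 2 ^ E := Nat.one_le_two_pow
  refine (Spec.seq (T := 1) <| Spec.set (fun _ => by simpa using h1E) <| Spec.seq (T := 1) <|
    Spec.set (fun _ => by simpa using h1E) <|
    Spec.forLoop (fun x τ => PartialSubsets n s (fun _ => x) (τ.reg 7) (τ.arr 2) (τ.arr 3) ∧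
      τ.reg 11 = 2 ^ x ∧ ∀ y < x, τ.arr 1 y = 2 ^ y) n (7 * n.choose s + 5)
      (by decide) (fun τ hf => ?_) hnE ?_ (fun x hx τ hf h8 hI => ?_)
      fun τ _ _ hI => ⟨hI.1, hI.2.2⟩).imp (by linarith) fun _ _ h => h
  · rw [Expr.eval_reg, hf.1 3 (by decide)]
    simpa using h3
  · simpa using PartialSubsets.start hsn hS hK
  · obtain ⟨hP, h11, hpow⟩ := hI
    have hxE : 2 ^ x ≤ 2 ^ E := Nat.pow_le_pow_right (by norm_num) (by omega)
    have hxE' : 2 ^ x * 2 ≤ 2 ^ E := by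
      rw [← pow_succ]; exact Nat.pow_le_pow_right (by norm_num) (by omega)
    have h3' : τ.reg 3 = n := by rw [hf.1 3 (by decide)]; simpa using h3
    have h4' : τ.reg 4 = s := by rw [hf.1 4 (by decide)]; simpa using h4
    have hle := hP.le_choose
    set N := τ.reg 7 with hN
    refine (Spec.seq (T := 1) <| Spec.store (fun _ => by simpa [h11] using hxE) <|
      Spec.seq (T := 1) <| Spec.set (fun _ => by simpa using hle.trans hC) <|
      Spec.seq (U := 1) <| Spec.forLoop (fun j υ => N ≤ υ.reg 7 ∧ PartialSubsets n s
        (fun i => if i < j ∨ N ≤ i then x + 1 else x) (υ.reg 7) (υ.arr 2) (υ.arr 3)) N 5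
        (by decide) (fun υ hf' => ?_) (hle.trans hC) ?_ (fun j hj υ hf' h9 hI => ?_)
        fun υ hf' _ hI => ?_).imp (by omega) fun _ _ h => h
    · rw [Expr.eval_reg, hf'.1 10 (by decide)]
      simp [hN]
    · simp only [State.reg_setReg, State.arr_setReg, State.reg_setArr, State.arr_setArr, ← hN]
      refine ⟨le_rfl, hP.congr (fun i hi => ?_) (fun _ _ => rfl) fun _ _ => rfl⟩
      rw [if_neg (by omega)]
    · refine (splitSubset_spec (n := n) (s := s) (x := x) ?_ ?_ ?_ h9 ?_ hx hj hn (hsn.trans hnE)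
        hC hI.1 hI.2).imp le_rfl fun φ _ h => ?_
      · rw [hf'.1 3 (by decide)]; simpa using h3'
      · rw [hf'.1 4 (by decide)]; simpa using h4'
      · rw [hf'.1 8 (by decide)]; simpa using h8
      · rw [hf'.1 11 (by decide)]; simpa using h11
      · simpa using h
    · have h11' : υ.reg 11 = 2 ^ x := by rw [hf'.1 11 (by decide)]; simpa using h11
      refine Spec.set (fun _ => by simpa [h11'] using hxE') ?_
      refine ⟨?_, by simp [h11', pow_succ], fun y hy => ?_⟩
      · refine hI.2.congr (fun i hi => ?_) (fun _ _ => rfl) fun _ _ => rfl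
        rw [if_pos (by omega)]
      · simp only [State.arr_setReg]
        rw [hf'.2 1 (by decide)]
        simp only [State.arr_setReg, State.arr_setArr, if_true, Expr.eval_reg, h8, h11,
          Function.update_apply]
        split_ifs with hyx
        · rw [hyx]
        · exact hpow y (by omega)

/-- The number of common elements of the set with mask `S (k / R)` and the list of numbers in the
cells of `a` that describes the hyperedge with index `k % R`. -/
def commonCount (R D : ℕ) (a S : ℕ → ℕ) (t k : ℕ) : ℕ :=
  ∑ i ∈ Finset.range t, S (k / R) / 2 ^ a (5 + k % R * D + i) % 2

theorem commonCount_le (R D : ℕ) (a S : ℕ → ℕ) (t k : ℕ) : commonCount R D a S t k ≤ t := by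
  calc commonCount R D a S t k ≤ ∑ i ∈ Finset.range t, 1 :=
        Finset.sum_le_sum fun i _ => by omega
    _ = t := by simp

/-- Membership of a vertex is a bit of the mask, extracted by dividing by a power of two from the
table in array `1`. The counts accumulate in cells that are initially zero. -/
theorem countCommon_spec {E n m r R C : ℕ} {σ : State} (h2 : σ.reg 2 = m) (h5 : σ.reg 5 = r)
    (h6 : σ.reg 6 = R) (h7 : σ.reg 7 = C) (hpow : ∀ y < n, σ.arr 1 y = 2 ^ y)
    (h0 : ∀ k, σ.arr 4 k = 0) (hR : 0 < R)
    (hv : ∀ i < R, ∀ t < r, σ.arr 0 (5 + i * (r + m) + t) < n)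
    (hr : r ≤ 2 ^ E) (hCR : C * R ≤ 2 ^ E) :
    Spec E countCommon σ (r * (3 * (C * R) + 4) + 2) fun τ =>
      ∀ k < C * R, τ.arr 4 k = commonCount R (r + m) (σ.arr 0) (σ.arr 2) r k := by
  refine (Spec.forLoop (fun t τ => ∀ k, τ.arr 4 k =
      if k < C * R then commonCount R (r + m) (σ.arr 0) (σ.arr 2) t k else 0) r (3 * (C * R) + 2)
      (by decide) (fun τ hf => ?_) hr ?_ (fun t ht τ hf h14 hI => ?_)
      fun τ _ _ hI k hk => ?_).imp (by linarith) fun _ _ h => h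
  · rw [Expr.eval_reg, hf.1 5 (by decide), h5]
  · intro k
    simp [commonCount, h0]
  · refine Spec.fill (fun k => commonCount R (r + m) (σ.arr 0) (σ.arr 2) (t + 1) k) (C * R)
      (fun υ hf' => ?_) hCR (fun k _ => (commonCount_le _ _ _ _ _ _).trans (by omega))
      (fun k hk υ hf' h12 hsame => ?_) fun υ hf' h k => ?_
    · simp only [Expr.eval_mul, Expr.eval_reg]
      rw [hf'.1 7 (by decide), hf'.1 6 (by decide), hf.1 7 (by decide), hf.1 6 (by decide), h6, h7]
    · have e0 : υ.arr 0 = σ.arr 0 := (hf'.2 0 (by decide)).trans (hf.2 0 (by decide))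
      have e1 : υ.arr 1 = σ.arr 1 := (hf'.2 1 (by decide)).trans (hf.2 1 (by decide))
      have e2 : υ.arr 2 = σ.arr 2 := (hf'.2 2 (by decide)).trans (hf.2 2 (by decide))
      have r2 : υ.reg 2 = m := by rw [hf'.1 2 (by decide), hf.1 2 (by decide), h2]
      have r5 : υ.reg 5 = r := by rw [hf'.1 5 (by decide), hf.1 5 (by decide), h5]
      have r6 : υ.reg 6 = R := by rw [hf'.1 6 (by decide), hf.1 6 (by decide), h6]
      have r14 : υ.reg 14 = t := by rw [hf'.1 14 (by decide), h14]
      simp only [Expr.eval_add, Expr.eval_mul, Expr.eval_div, Expr.eval_mod, Expr.eval_reg,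
        Expr.eval_arr, Expr.eval_lit, h12, e0, e1, e2, r2, r5, r6, r14, hsame k le_rfl, hI k,
        if_pos hk]
      rw [hpow _ (hv _ (Nat.mod_lt _ hR) _ ht), commonCount, commonCount, Finset.sum_range_succ]
    · simp only [State.arr_setReg, h k, hI k]
      split_ifs <;> rfl
  · rw [hI k, if_pos hk]

/-- By truncation, `1 - (s - count)` is 1 if at least `s` elements are common and 0 otherwise. The
first loop also writes irrelevant values to the first `C` columns, which the second loop overwrites.
-/
theorem writeMatrix_spec {E m s r R C : ℕ} {σ : State} (h2 : σ.reg 2 = m) (h4 : σ.reg 4 = s)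
    (h5 : σ.reg 5 = r) (h6 : σ.reg 6 = R) (h7 : σ.reg 7 = C) (hN : (C + m) * R ≤ 2 ^ E) :
    Spec E writeMatrix σ (3 * ((C + m) * R) + 3 * (C * R) + 4) fun τ =>
      ∀ k < (C + m) * R, τ.arr 5 k = if k < C * R then 1 - (s - σ.arr 4 k) else
        σ.arr 0 (5 + k % R * (r + m) + (r + (k / R - C))) := by
  refine Spec.of_bdd fun hb => ?_
  refine (Spec.seq <| Spec.fill
    (fun k => σ.arr 0 (5 + k % R * (r + m) + (r + (k / R - C)))) ((C + m) * R)
    (fun τ hf => ?_) hN (fun k _ => hb.2 _ _) (fun k hk τ hf h12 _ => ?_) fun τ hf h =>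
    Spec.fill (fun k => 1 - (s - σ.arr 4 k)) (C * R) (fun υ hf' => ?_)
      (le_trans (Nat.mul_le_mul_right _ (by omega)) hN)
      (fun k _ => le_trans (by omega) (Nat.one_le_two_pow (n := E)))
      (fun k hk υ hf' h12 _ => ?_) fun υ hf' h' k hk => ?_).imp (by omega) fun _ _ h => h
  · simp only [Expr.eval_mul, Expr.eval_add, Expr.eval_reg]
    rw [hf.1 7 (by decide), hf.1 6 (by decide), hf.1 2 (by decide), h2, h6, h7]
  · simp only [Expr.eval_add, Expr.eval_sub, Expr.eval_mul, Expr.eval_div, Expr.eval_mod,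
      Expr.eval_reg, Expr.eval_arr, Expr.eval_lit, h12]
    rw [hf.2 0 (by decide), hf.1 7 (by decide), hf.1 6 (by decide), hf.1 5 (by decide),
      hf.1 2 (by decide), h2, h5, h6, h7]
  · simp only [Expr.eval_mul, Expr.eval_reg]
    rw [hf'.1 7 (by decide), hf'.1 6 (by decide), hf.1 7 (by decide), hf.1 6 (by decide), h6, h7]
  · simp only [Expr.eval_sub, Expr.eval_reg, Expr.eval_arr, Expr.eval_lit, h12]
    rw [hf'.2 4 (by decide), hf.2 4 (by decide), hf'.1 4 (by decide), hf.1 4 (by decide), h4]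
  · rw [h' k, h k, if_pos hk]

/-- The matrix is overwritten in place, so the pivot, its column and its row are saved beforehand;
the only other entry used for cell `k` is cell `k` itself, not yet overwritten. -/
theorem pivotStep_spec {E p m R C q : ℕ} {σ : State} (h1 : σ.reg 1 = p) (h2 : σ.reg 2 = m)
    (h6 : σ.reg 6 = R) (h7 : σ.reg 7 = C) (h13 : σ.reg 13 = q) (hq : q < C * R)
    (hN : (C + m) * R ≤ 2 ^ E) (hNE : C + m ≤ 2 ^ E) (hp : p ≤ 2 ^ E) (hp0 : 0 < p) :
    Spec E pivotStep σ (3 * ((C + m) * R) + 3 * (C + m) + 3 * R + 7) fun τ =>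
      ∀ k < (C + m) * R, τ.arr 5 k = eliminate p R (σ.arr 5) q k := by
  have hR : 0 < R := Nat.pos_of_ne_zero (by rintro rfl; simp at hq)
  have hRE : R ≤ 2 ^ E := by
    refine le_trans (Nat.le_mul_of_pos_left R (Nat.pos_of_ne_zero ?_)) hN
    intro h
    have : C = 0 := by omega
    simp [this] at hq
  refine Spec.of_bdd fun hb => ?_
  refine (Spec.seq <| Spec.fill (fun k => σ.arr 5 (q / R * R + k)) R (fun τ hf => ?_) hRE
    (fun k _ => hb.2 _ _) (fun k hk τ hf h12 _ => ?_) fun τ hf hU => Spec.seq <|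
    Spec.fill (fun k => σ.arr 5 (k * R + q % R)) (C + m) (fun υ hf' => ?_) hNE
      (fun k _ => hb.2 _ _) (fun k hk υ hf' h12 _ => ?_) fun υ hf' hW => Spec.seq (T := 1) <|
    Spec.set (e := .arr 5 (.reg 13)) (fun hb' => hb'.2 _ _) <|
    Spec.fill (fun k => eliminate p R (σ.arr 5) q k) ((C + m) * R) (fun φ hg => ?_) hN
      (fun k _ => (Nat.mod_lt _ hp0).le.trans hp) (fun k hk φ hg h12 hsame => ?_)
      fun φ _ h k hk => ?_).imp (by omega) fun _ _ h => h
  · rw [Expr.eval_reg, hf.1 6 (by decide), h6]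
  · simp only [Expr.eval_add, Expr.eval_mul, Expr.eval_div, Expr.eval_reg, Expr.eval_arr, h12]
    rw [hf.2 5 (by decide), hf.1 13 (by decide), hf.1 6 (by decide), h6, h13]
  · simp only [Expr.eval_add, Expr.eval_reg]
    rw [hf'.1 7 (by decide), hf'.1 2 (by decide), hf.1 7 (by decide), hf.1 2 (by decide), h7, h2]
  · simp only [Expr.eval_add, Expr.eval_mul, Expr.eval_mod, Expr.eval_reg, Expr.eval_arr, h12]
    rw [hf'.2 5 (by decide), hf'.1 13 (by decide), hf'.1 6 (by decide), hf.2 5 (by decide),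
      hf.1 13 (by decide), hf.1 6 (by decide), h6, h13]
  · simp only [Expr.eval_add, Expr.eval_mul, Expr.eval_reg]
    rw [hg.1 7 (by decide), hg.1 6 (by decide), hg.1 2 (by decide)]
    simp only [State.reg_setReg, Nat.reduceEqDiff, if_false]
    rw [hf'.1 7 (by decide), hf'.1 6 (by decide), hf'.1 2 (by decide), hf.1 7 (by decide),
      hf.1 6 (by decide), hf.1 2 (by decide), h7, h6, h2]
  · have s5 : υ.arr 5 = σ.arr 5 := (hf'.2 5 (by decide)).trans (hf.2 5 (by decide))
    have s13 : υ.reg 13 = q := by rw [hf'.1 13 (by decide), hf.1 13 (by decide), h13]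
    have r1 : φ.reg 1 = p := by
      rw [hg.1 1 (by decide)]
      simpa [hf'.1 1 (by decide), hf.1 1 (by decide)] using h1
    have r6 : φ.reg 6 = R := by
      rw [hg.1 6 (by decide)]
      simpa [hf'.1 6 (by decide), hf.1 6 (by decide)] using h6
    have r11 : φ.reg 11 = σ.arr 5 q := by
      rw [hg.1 11 (by decide)]
      simp [s5, s13]
    have e5 : φ.arr 5 k = σ.arr 5 k := by
      rw [hsame k le_rfl, State.arr_setReg, s5]
    have e6 : φ.arr 6 (k % R) = σ.arr 5 (q / R * R + k % R) := by
      rw [hg.2 6 (by decide), State.arr_setReg, hf'.2 6 (by decide), hU, if_pos (Nat.mod_lt _ hR)]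
    have e7 : φ.arr 7 (k / R) = σ.arr 5 (k / R * R + q % R) := by
      rw [hg.2 7 (by decide), State.arr_setReg, hW,
        if_pos (Nat.div_lt_of_lt_mul (by rwa [mul_comm]))]
    simp only [Expr.eval_add, Expr.eval_sub, Expr.eval_mul, Expr.eval_div, Expr.eval_mod,
      Expr.eval_reg, Expr.eval_arr, h12, r1, r6, r11, e5, e6, e7, eliminate]
  · rw [h k, if_pos hk]

theorem eliminateAll_spec {E p m R C : ℕ} [Fact p.Prime] {σ : State} (h1 : σ.reg 1 = p)
    (h2 : σ.reg 2 = m) (h6 : σ.reg 6 = R) (h7 : σ.reg 7 = C)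
    (hM : ∀ k < (C + m) * R, σ.arr 5 k < p)
    (hN : (C + m) * R ≤ 2 ^ E) (hNE : C + m ≤ 2 ^ E) (hp : p ≤ 2 ^ E) :
    Spec E eliminateAll σ (C * R * (3 * ((C + m) * R) + 3 * (C + m) + 3 * R + 10) + 2) fun τ =>
      (∀ k < C * R, τ.arr 5 k = 0) ∧ (∀ k < (C + m) * R, τ.arr 5 k < p) ∧
      ∀ j < C + m, FlatSolvable p R C (τ.arr 5) j ↔ FlatSolvable p R C (σ.arr 5) j := by
  have hCN : C * R ≤ (C + m) * R := Nat.mul_le_mul_right _ (by omega)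
  have hp0 : 0 < p := (Fact.out : p.Prime).pos
  refine (Spec.forLoop (fun q τ => (∀ k < q, τ.arr 5 k = 0) ∧ (∀ k < (C + m) * R, τ.arr 5 k < p) ∧
      ∀ j < C + m, FlatSolvable p R C (τ.arr 5) j ↔ FlatSolvable p R C (σ.arr 5) j) (C * R)
      (3 * ((C + m) * R) + 3 * (C + m) + 3 * R + 8)
      (by decide) (fun τ hf => ?_) (hCN.trans hN) ?_ (fun q hq τ hf h13 hI => ?_)
      fun τ _ _ hI => hI).imp (by linarith) fun _ _ h => h
  · simp only [Expr.eval_mul, Expr.eval_reg]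
    rw [hf.1 7 (by decide), hf.1 6 (by decide), h6, h7]
  · exact ⟨by simp, hM, fun _ _ => Iff.rfl⟩
  · obtain ⟨hz, hlt, hiff⟩ := hI
    have hR : 0 < R := Nat.pos_of_ne_zero (by rintro rfl; simp at hq)
    refine Spec.ite (T := 3 * ((C + m) * R) + 3 * (C + m) + 3 * R + 7) (fun hne => ?_) fun heq => ?_
    · simp only [Expr.eval_arr, Expr.eval_reg, h13] at hne
      refine (pivotStep_spec (p := p) (m := m) (R := R) (C := C) ?_ ?_ ?_ ?_ h13 hq hN hNE hp
        hp0).imp le_rfl fun υ _ h => ?_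
      · rw [hf.1 1 (by decide), h1]
      · rw [hf.1 2 (by decide), h2]
      · rw [hf.1 6 (by decide), h6]
      · rw [hf.1 7 (by decide), h7]
      · simp only [State.arr_setReg]
        refine ⟨fun k hk => ?_, fun k hk => ?_, fun j hj => ?_⟩
        · rw [h k (by omega)]
          exact eliminate_eq_zero hR (hq.trans_le hCN) hlt hz (by omega)
        · rw [h k hk]
          exact Nat.mod_lt _ hp0
        · rw [← hiff j hj]
          exact flatSolvable_eliminate (by omega) hq hlt h hne hj
    · simp only [Expr.eval_arr, Expr.eval_reg, h13] at heq
      refine (Spec.skip ?_).imp (by omega) fun _ _ h => h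
      simp only [State.arr_setReg]
      refine ⟨fun k hk => ?_, hlt, hiff⟩
      rcases (Nat.lt_succ_iff.1 hk).lt_or_eq with h | rfl
      · exact hz k h
      · exact heq

/-- A factor is 1 for a zero entry and 0 otherwise, so the product is the indicator of the zero
matrix. -/
theorem checkZero_spec {E m R C : ℕ} {σ : State} (h2 : σ.reg 2 = m) (h6 : σ.reg 6 = R)
    (h7 : σ.reg 7 = C) (hN : (C + m) * R ≤ 2 ^ E) :
    Spec E checkZero σ (3 * ((C + m) * R) + 3) fun τ =>
      τ.reg 0 = ∏ k ∈ Finset.range ((C + m) * R), (1 - σ.arr 5 k) := by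
  have hle : ∀ t, ∏ k ∈ Finset.range t, (1 - σ.arr 5 k) ≤ 1 := fun t =>
    Finset.prod_le_one (by simp) fun k _ => by omega
  have h1E : 1 ≤ 2 ^ E := Nat.one_le_two_pow
  refine (Spec.seq (T := 1) <| Spec.set (fun _ => by simpa using h1E) <|
    Spec.forLoop (fun t τ => τ.reg 0 = ∏ k ∈ Finset.range t, (1 - σ.arr 5 k)) ((C + m) * R) 1
      (by decide) (fun τ hf => ?_) hN (by simp) (fun t ht τ hf h12 hI => ?_)
      fun τ _ _ h => h).imp (by omega) fun _ _ h => h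
  · simp only [Expr.eval_mul, Expr.eval_add, Expr.eval_reg]
    rw [hf.1 7 (by decide), hf.1 6 (by decide), hf.1 2 (by decide)]
    simp [h2, h6, h7]
  · have hval : (Expr.reg 0 * (Expr.lit 1 - Expr.arr 5 (Expr.reg 12))).eval τ =
        ∏ k ∈ Finset.range (t + 1), (1 - σ.arr 5 k) := by
      simp only [Expr.eval_mul, Expr.eval_sub, Expr.eval_reg, Expr.eval_lit, Expr.eval_arr, h12, hI]
      rw [hf.2 5 (by decide), Finset.prod_range_succ]
      rfl
    refine Spec.set (fun _ => hval ▸ (hle _).trans h1E) ?_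
    simp [hval]

end RAM

/-! ### Correctness and step count of the whole program -/

namespace RAM

theorem flatSolvable_iff_of_eq_zero {p R C N : ℕ} {M : ℕ → ℕ} (hz : ∀ k < C * R, M k = 0)
    (hlt : ∀ k < N * R, M k < p) {j : ℕ} (hj : j < N) :
    FlatSolvable p R C M j ↔ ∀ i < R, M (j * R + i) = 0 := by
  have h0 : ∀ (c : ℕ → ZMod p) (i : ℕ), i < R →
      ∑ j ∈ Finset.range C, c j * flatColumn p R M j i = 0 := fun c i hi =>
    Finset.sum_eq_zero fun j hj => by
      rw [flatColumn, hz _ (mul_add_lt (Finset.mem_range.1 hj) hi), Nat.cast_zero, mul_zero]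
  constructor
  · rintro ⟨c, hc⟩ i hi
    have h := hc i hi
    rw [h0 c i hi, flatColumn, ZMod.natCast_eq_zero_iff] at h
    exact Nat.eq_zero_of_dvd_of_lt h (hlt _ (mul_add_lt hj hi))
  · intro h
    exact ⟨0, fun i hi => by rw [h0 _ i hi, flatColumn, h i hi, Nat.cast_zero]⟩

-- The matrix has at most `X * X` entries, and at most that many pivots each cost order `X * X`
-- steps, whence the fourth power. `M` is the matrix before elimination, which the final state no
-- longer contains.
open Classical in
theorem decideImage_spec {E X p m n s r R : ℕ} [Fact p.Prime] {σ : State}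
    (h0 : σ.arr 0 0 = p) (h1 : σ.arr 0 1 = m) (h2 : σ.arr 0 2 = n) (h3 : σ.arr 0 3 = s)
    (h4 : σ.arr 0 4 = r) (hlen : σ.reg 0 = 5 + R * (r + m)) (harr : ∀ k ≠ 0, ∀ i, σ.arr k i = 0)
    (hsn : s ≤ n) (hR : 0 < R) (hrm : 0 < r + m)
    (hv : ∀ i < R, ∀ t < r, σ.arr 0 (5 + i * (r + m) + t) < n)
    (hc : ∀ i < R, ∀ j < m, σ.arr 0 (5 + i * (r + m) + (r + j)) < p)
    (hX : n.choose s + R + m ≤ X) (hn : n ≤ X) (hr : r ≤ X) (hE : X * X + X + 1 ≤ E)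
    (hp : p ≤ 2 ^ E) :
    Spec E decideImage σ (21 * (X + 1) ^ 4) fun τ => ∃ (C : ℕ) (S K M : ℕ → ℕ),
      PartialSubsets n s (fun _ => n) C S K ∧
      (∀ k < (C + m) * R, M k = if k < C * R then
        1 - (s - commonCount R (r + m) (σ.arr 0) S r k) else
        σ.arr 0 (5 + k % R * (r + m) + (r + (k / R - C)))) ∧
      τ.reg 0 = if ∀ j < m, FlatSolvable p R C M (C + j) then 1 else 0 := by
  have hE2 : E ≤ 2 ^ E := Nat.lt_two_pow_self.le
  have hp1 : 1 < p := (Fact.out : p.Prime).one_lt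
  have hdiv : (σ.reg 0 - 5) / (r + m) = R := by
    rw [hlen, Nat.add_sub_cancel_left, Nat.mul_div_cancel _ hrm]
  refine (Spec.seq (U := X * (7 * X + 7) + 4 + (X * (3 * (X * X) + 4) + 2 +
    (6 * (X * X) + 4 + (X * X * (3 * (X * X) + 6 * X + 10) + 2 + (3 * (X * X) + 3))))) <|
    (parseHeader_spec (E := E) (σ := σ) ?_).imp le_rfl fun τ hf hτ => ?_).imp ?_ fun _ _ h => h
  · rw [h4, h1, hdiv]; omega
  rotate_left
  · nlinarith [Nat.zero_le (X ^ 4), Nat.zero_le (X ^ 3), Nat.zero_le (X ^ 2)]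
  rw [h0, h1, h2, h3, h4, hdiv] at hτ
  obtain ⟨ha, g1, g2, g3, g4, g5, g6⟩ := hτ
  have hnX : n * (7 * n.choose s + 7) ≤ X * (7 * X + 7) := Nat.mul_le_mul hn (by omega)
  refine Spec.seq <| (listSubsets_spec g3 g4 (by rw [ha, harr _ (by decide)])
    (by rw [ha, harr _ (by decide)]) hsn (by nlinarith) (by omega)).imp (by omega)
    fun υ hf2 h => ?_
  obtain ⟨hP, hpow⟩ := h
  have ha2 : υ.arr 0 = σ.arr 0 := by rw [hf2.2 0 (by decide), ha]
  replace g1 : υ.reg 1 = p := by rw [hf2.1 1 (by decide), g1]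
  replace g2 : υ.reg 2 = m := by rw [hf2.1 2 (by decide), g2]
  replace g4 : υ.reg 4 = s := by rw [hf2.1 4 (by decide), g4]
  replace g5 : υ.reg 5 = r := by rw [hf2.1 5 (by decide), g5]
  replace g6 : υ.reg 6 = R := by rw [hf2.1 6 (by decide), g6]
  obtain ⟨C, g7⟩ : ∃ C, υ.reg 7 = C := ⟨_, rfl⟩
  rw [g7] at hP
  have hC := hP.le_choose
  have hNR : (C + m) * R ≤ X * X := Nat.mul_le_mul (by omega) (by omega)
  have hCR : C * R ≤ (C + m) * R := Nat.mul_le_mul_right _ (by omega)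
  refine Spec.seq <| (countCommon_spec (n := n) g2 g5 g6 g7 hpow (fun k => ?_) hR ?_ (by omega)
    (by omega)).imp (Nat.add_le_add_right (Nat.mul_le_mul hr (by omega)) _) fun φ hf3 hcnt => ?_
  · rw [hf2.2 4 (by decide), ha, harr _ (by decide)]
  · rw [ha2]; exact hv
  rw [ha2] at hcnt
  replace g1 : φ.reg 1 = p := by rw [hf3.1 1 (by decide), g1]
  replace g2 : φ.reg 2 = m := by rw [hf3.1 2 (by decide), g2]
  replace g4 : φ.reg 4 = s := by rw [hf3.1 4 (by decide), g4]
  replace g5 : φ.reg 5 = r := by rw [hf3.1 5 (by decide), g5]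
  replace g6 : φ.reg 6 = R := by rw [hf3.1 6 (by decide), g6]
  replace g7 : φ.reg 7 = C := by rw [hf3.1 7 (by decide), g7]
  have ha3 : φ.arr 0 = σ.arr 0 := by rw [hf3.2 0 (by decide), ha2]
  refine Spec.seq <| (writeMatrix_spec g2 g4 g5 g6 g7 (by omega)).imp (by omega)
    fun ψ hf4 hM => ?_
  rw [ha3] at hM
  have hM' : ∀ k < (C + m) * R, ψ.arr 5 k = if k < C * R then
      1 - (s - commonCount R (r + m) (σ.arr 0) (υ.arr 2) r k) else
      σ.arr 0 (5 + k % R * (r + m) + (r + (k / R - C))) := by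
    intro k hk
    rw [hM k hk]
    split_ifs with h
    · rw [hcnt k h]
    · rfl
  have hlt : ∀ k < (C + m) * R, ψ.arr 5 k < p := by
    intro k hk
    rw [hM' k hk]
    split_ifs with h
    · omega
    · refine hc _ (Nat.mod_lt _ hR) _ ?_
      have h1 : k / R < C + m := Nat.div_lt_of_lt_mul (by rwa [mul_comm])
      have h2 : C ≤ k / R := (Nat.le_div_iff_mul_le hR).2 (by omega)
      omega
  replace g1 : ψ.reg 1 = p := by rw [hf4.1 1 (by decide), g1]
  replace g2 : ψ.reg 2 = m := by rw [hf4.1 2 (by decide), g2]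
  replace g6 : ψ.reg 6 = R := by rw [hf4.1 6 (by decide), g6]
  replace g7 : ψ.reg 7 = C := by rw [hf4.1 7 (by decide), g7]
  refine Spec.seq <| (eliminateAll_spec g1 g2 g6 g7 hlt (by omega) (by omega) hp).imp
    (Nat.add_le_add_right (Nat.mul_le_mul (by omega) (by omega)) _) fun χ hf5 h => ?_
  obtain ⟨hz, hlt', hiff⟩ := h
  replace g2 : χ.reg 2 = m := by rw [hf5.1 2 (by decide), g2]
  replace g6 : χ.reg 6 = R := by rw [hf5.1 6 (by decide), g6]
  replace g7 : χ.reg 7 = C := by rw [hf5.1 7 (by decide), g7]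
  refine (checkZero_spec g2 g6 g7 (by omega)).imp (by omega) fun ω _ hω => ?_
  refine ⟨C, υ.arr 2, υ.arr 3, ψ.arr 5, hP, hM', ?_⟩
  rw [hω]
  have hall : (∀ j < m, FlatSolvable p R C (ψ.arr 5) (C + j)) ↔
      ∀ k < (C + m) * R, χ.arr 5 k = 0 := by
    constructor
    · intro h k hk
      by_cases hkC : k < C * R
      · exact hz k hkC
      · have h1 : k / R < C + m := Nat.div_lt_of_lt_mul (by rwa [mul_comm])
        have h2 : C ≤ k / R := (Nat.le_div_iff_mul_le hR).2 (by omega)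
        have h3 := h (k / R - C) (by omega)
        rw [Nat.add_sub_cancel' h2, ← hiff _ h1, flatSolvable_iff_of_eq_zero hz hlt' h1] at h3
        simpa [Nat.div_add_mod'] using h3 (k % R) (Nat.mod_lt _ hR)
    · intro h j hj
      rw [← hiff _ (by omega), flatSolvable_iff_of_eq_zero hz hlt' (by omega)]
      exact fun i hi => h _ (mul_add_lt (by omega) hi)
  split_ifs with h
  · exact Finset.prod_eq_one fun k hk => by
      rw [hall.1 h k (Finset.mem_range.1 hk), Nat.sub_zero]
  · rw [hall] at h
    push Not at h
    obtain ⟨k, hk, hne⟩ := h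
    exact Finset.prod_eq_zero (Finset.mem_range.2 hk) (by omega)

end RAM

/-! ### The image of the lifting map -/

/-- The lifting map only adds values, so it commutes with taking coordinates over the subfield. -/
theorem mem_range_liftingMap_iff_coord {K F : Type*} [Field K] [Field F] [Algebra K F]
    {ι : Type*} [Fintype ι] (b : Module.Basis ι K F) {n s r : ℕ} (g : HyperedgeColoring F n r) :
    g ∈ LinearMap.range (liftingMap F n s r) ↔
      ∀ j, (fun e => b.repr (g e) j) ∈ LinearMap.range (liftingMap K n s r) := by
  constructor
  · rintro ⟨f, rfl⟩ j
    refine ⟨fun e => b.repr (f e) j, ?_⟩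
    funext e
    simp [liftingMap, map_sum, Finsupp.finsetSum_apply]
  · intro h
    choose f hf using h
    refine ⟨fun e => ∑ j, f j e • b j, ?_⟩
    funext e
    rw [← b.sum_repr (g e)]
    simp only [← fun j => congrFun (hf j) e]
    simp only [liftingMap, LinearMap.coe_mk, AddHom.coe_mk, Finset.sum_smul]
    exact Finset.sum_comm

/-- The image is spanned by the lifts of the indicators of single `s`-sets. The list `A` need not be
free of repetitions. -/
theorem mem_range_liftingMap_iff {K : Type*} [Field K] {n s r C : ℕ} {A : ℕ → Finset ℕ}
    (hA : ∀ j < C, A j ⊆ Finset.range n ∧ (A j).card = s)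
    (hcov : ∀ T ⊆ Finset.range n, T.card = s → ∃ j < C, A j = T) (h : HyperedgeColoring K n r) :
    h ∈ LinearMap.range (liftingMap K n s r) ↔ ∃ c : ℕ → K, ∀ e, h e =
      ∑ j ∈ Finset.range C, c j * if A j ⊆ e.1.map Fin.valEmbedding then 1 else 0 := by
  constructor
  · rintro ⟨f, rfl⟩
    have hidx : ∀ T : Hyperedge n s, ∃ j < C, A j = T.1.map Fin.valEmbedding := fun T =>
      hcov _ (fun x hx => by
        obtain ⟨y, -, rfl⟩ := Finset.mem_map.1 hx
        simp) (by rw [Finset.card_map, T.2])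
    choose idx hidx hAidx using hidx
    -- Each `s`-set contributes to one chosen index; indices that are never chosen get coefficient
    -- 0.
    refine ⟨fun j => ∑ T with idx T = j, f T, fun e => ?_⟩
    have h1 : ∀ j ∈ Finset.range C, (∑ T with idx T = j, f T) *
        (if A j ⊆ e.1.map Fin.valEmbedding then (1 : K) else 0) =
        ∑ T with idx T = j, if T.1 ⊆ e.1 then f T else 0 := by
      intro j _
      rw [Finset.sum_mul]
      refine Finset.sum_congr rfl fun T hT => ?_
      obtain rfl := (Finset.mem_filter.1 hT).2
      simp only [hAidx, Finset.map_subset_map, mul_ite, mul_one, mul_zero]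
    rw [Finset.sum_congr rfl h1, Finset.sum_fiberwise_of_maps_to fun T _ =>
      Finset.mem_range.2 (hidx T)]
    simp [liftingMap, Finset.sum_filter]
  · rintro ⟨c, hc⟩
    have hset : ∀ j, ∃ T : HyperedgeColoring K n s, j < C → ∀ e,
        liftingMap K n s r T e = if A j ⊆ e.1.map Fin.valEmbedding then 1 else 0 := by
      intro j
      by_cases hj : j < C
      · obtain ⟨hAn, hAs⟩ := hA j hj
        obtain ⟨B, hB⟩ : ∃ B : Finset (Fin n), B.map Fin.valEmbedding = A j :=
          ⟨_, Finset.map_valEmbedding_attachFin fun x hx => Finset.mem_range.1 (hAn hx)⟩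
        have hBs : B.card = s := by rw [← hAs, ← hB, Finset.card_map]
        refine ⟨Pi.single ⟨B, hBs⟩ 1, fun _ e => ?_⟩
        simp only [← hB, Finset.map_subset_map]
        simp only [liftingMap, LinearMap.coe_mk, AddHom.coe_mk, Pi.single_apply,
          Finset.sum_ite_eq', Finset.mem_filter, Finset.mem_univ, true_and]
      · exact ⟨0, fun h => absurd h hj⟩
    choose T hT using hset
    refine ⟨∑ j ∈ Finset.range C, c j • T j, ?_⟩
    funext e
    rw [map_sum, Finset.sum_apply, hc e]
    refine Finset.sum_congr rfl fun j hj => ?_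
    rw [map_smul, Pi.smul_apply, hT j (Finset.mem_range.1 hj) e, smul_eq_mul]

/-! ### The input -/

theorem List.getD_flatMap_of_length_eq {α β : Type*} {D : ℕ} {f : α → List β}
    (hf : ∀ a, (f a).length = D) (L : List α) {i t : ℕ} (hi : i < L.length) (ht : t < D) (d : β) :
    (L.flatMap f).getD (i * D + t) d = (f L[i]).getD t d := by
  induction L generalizing i with
  | nil => simp at hi
  | cons a L ih =>
    rw [List.flatMap_cons]
    cases i with
    | zero =>
      rw [List.getD_append _ _ _ _ (by rw [hf]; omega)]
      simp
    | succ i =>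
      rw [List.getD_append_right _ _ _ _ (by rw [hf, add_mul]; omega), hf,
        show (i + 1) * D + t - D = i * D + t by rw [add_mul]; omega]
      exact ih (by simpa using hi)

theorem List.length_flatMap_of_length_eq {α β : Type*} {D : ℕ} {f : α → List β}
    (hf : ∀ a, (f a).length = D) (L : List α) : (L.flatMap f).length = L.length * D := by
  simp [List.length_flatMap, hf]

theorem List.sum_range_getD (l : List ℕ) (f : ℕ → ℕ) :
    ∑ t ∈ Finset.range l.length, f (l.getD t 0) = (l.map f).sum := by
  induction l with
  | nil => simp
  | cons a l ih =>
    rw [List.length_cons, Finset.sum_range_succ', List.map_cons, List.sum_cons, ← ih, add_comm]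
    simp

section Input

variable {p m n s r : ℕ} {F : Type*} [Field F] [Algebra (ZMod p) F]
  (b : Module.Basis (Fin m) (ZMod p) F) (L : List (Hyperedge n r)) (g : HyperedgeColoring F n r)

theorem length_coloringInput_block (e : Hyperedge n r) :
    ((e.1.sort (· ≤ ·)).map Fin.val ++ List.ofFn fun j => (b.repr (g e) j).val).length = r + m := by
  simp [e.2]

theorem length_coloringInput : (coloringInput b n s r L g).length = 5 + L.length * (r + m) := by
  rw [coloringInput, List.length_append,
    List.length_flatMap_of_length_eq (length_coloringInput_block b g)]
  rfl

theorem getD_coloringInput {i t : ℕ} (hi : i < L.length) (ht : t < r + m) :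
    (coloringInput b n s r L g).getD (5 + i * (r + m) + t) 0 =
      (((L[i]).1.sort (· ≤ ·)).map Fin.val ++
        List.ofFn fun j => (b.repr (g L[i]) j).val).getD t 0 := by
  rw [coloringInput, List.getD_append_right _ _ _ _ (by simp; omega),
    show 5 + i * (r + m) + t - [p, m, n, s, r].length = i * (r + m) + t by simp; omega,
    List.getD_flatMap_of_length_eq (length_coloringInput_block b g) L hi ht]

theorem getD_coloringInput_vertex {i t : ℕ} (hi : i < L.length) (ht : t < r) :
    (coloringInput b n s r L g).getD (5 + i * (r + m) + t) 0 =
      (((L[i]).1.sort (· ≤ ·)).map Fin.val).getD t 0 := by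
  rw [getD_coloringInput b L g hi (by omega), List.getD_append]
  simpa [(L[i]).2] using ht

theorem getD_coloringInput_vertex_lt {i t : ℕ} (hi : i < L.length) (ht : t < r) :
    (coloringInput b n s r L g).getD (5 + i * (r + m) + t) 0 < n := by
  rw [getD_coloringInput_vertex b L g hi ht, List.getD_eq_getElem _ _ (by simpa [(L[i]).2] using ht),
    List.getElem_map]
  exact Fin.isLt _

theorem getD_coloringInput_color {i : ℕ} (hi : i < L.length) (j : Fin m) :
    (coloringInput b n s r L g).getD (5 + i * (r + m) + (r + j)) 0 = (b.repr (g L[i]) j).val := by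
  have hl : (((L[i]).1.sort (· ≤ ·)).map Fin.val).length = r := by simp [(L[i]).2]
  rw [getD_coloringInput b L g hi (by omega), List.getD_append_right _ _ _ _ (by omega), hl,
    Nat.add_sub_cancel_left, List.getD_eq_getElem _ _ (by simp)]
  simp

/-- The sorted list has each vertex once, so summing the mask bits along it counts the intersection.
-/
theorem commonCount_coloringInput {S : ℕ → ℕ} {A : Finset ℕ} {i j : ℕ} (hi : i < L.length)
    (hS : S j = bitMask A) :
    RAM.commonCount L.length (r + m) (fun k => (coloringInput b n s r L g).getD k 0) S r
      (j * L.length + i) = (A ∩ (L[i]).1.map Fin.valEmbedding).card := by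
  obtain ⟨h1, h2⟩ := mul_add_div_mod j hi
  have hl : (((L[i]).1.sort (· ≤ ·)).map Fin.val).length = r := by simp [(L[i]).2]
  have h3 : RAM.commonCount L.length (r + m) (fun k => (coloringInput b n s r L g).getD k 0) S r
      (j * L.length + i) = ∑ t ∈ Finset.range (((L[i]).1.sort (· ≤ ·)).map Fin.val).length,
        if (((L[i]).1.sort (· ≤ ·)).map Fin.val).getD t 0 ∈ A then 1 else 0 := by
    rw [hl]
    refine Finset.sum_congr rfl fun t ht => ?_
    simp only [h1, h2, hS]
    rw [getD_coloringInput_vertex b L g hi (Finset.mem_range.1 ht), bitMask_div_mod]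
  rw [h3, List.sum_range_getD _ fun v => if v ∈ A then 1 else 0, List.map_map,
    ← Multiset.sum_coe, ← Multiset.map_coe, Finset.sort_eq, Finset.inter_comm,
    ← Finset.filter_mem_eq_inter, Finset.card_filter, Finset.sum_map]
  rfl

end Input

/-! ### Correctness of the answer and polynomial bounds -/

theorem bitMask_injective : Function.Injective bitMask := by
  intro A B h
  ext v
  have h1 := bitMask_div_mod A v
  rw [h, bitMask_div_mod B v] at h1
  by_cases hA : v ∈ A <;> by_cases hB : v ∈ B <;> simp_all

/-- This bounds `n` by the number of unknowns or of equations; the induction uses Pascal's rule. -/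
theorem le_choose_self {n s : ℕ} (hs : 0 < s) (hsn : s < n) : n ≤ n.choose s := by
  induction n generalizing s with
  | zero => omega
  | succ n ih =>
    obtain ⟨s, rfl⟩ : ∃ t, s = t + 1 := ⟨s - 1, by omega⟩
    rcases (Nat.lt_succ_iff.1 hsn).lt_or_eq with h | h
    · have h1 := ih (show 0 < s + 1 by omega) h
      have h2 := Nat.choose_pos (show s ≤ n by omega)
      rw [Nat.choose_succ_succ']
      omega
    · rw [h, Nat.choose_succ_self_right]

theorem Nat.size_pow_le {p m : ℕ} : (p ^ m).size ≤ m * p.size + 1 := by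
  rw [Nat.size_le]
  calc p ^ m ≤ (2 ^ p.size) ^ m := Nat.pow_le_pow_left (Nat.lt_size_self p).le m
    _ = 2 ^ (m * p.size) := by rw [← pow_mul, mul_comm]
    _ < _ := Nat.pow_lt_pow_right (by norm_num) (Nat.lt_succ_self _)

theorem Hyperedge.length_eq_choose {n r : ℕ} {L : List (Hyperedge n r)} (hL : L.Nodup)
    (hmem : ∀ e, e ∈ L) : L.length = n.choose r := by
  rw [← List.toFinset_card_of_nodup hL,
    (Finset.eq_univ_iff_forall.2 fun e => List.mem_toFinset.2 (hmem e) : L.toFinset = Finset.univ),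
    Finset.card_univ, Fintype.card_finset_len, Fintype.card_fin]

section Decision

variable {p m n s r : ℕ} [Fact p.Prime] {F : Type*} [Field F] [Algebra (ZMod p) F]
  (b : Module.Basis (Fin m) (ZMod p) F) {L : List (Hyperedge n r)} (g : HyperedgeColoring F n r)

theorem mem_range_liftingMap_iff_flatSolvable (hmem : ∀ e, e ∈ L) {C : ℕ} {S K M : ℕ → ℕ}
    (hP : PartialSubsets n s (fun _ => n) C S K)
    (hM : ∀ k < (C + m) * L.length, M k = if k < C * L.length then
      1 - (s - RAM.commonCount L.length (r + m)
        (fun c => (coloringInput b n s r L g).getD c 0) S r k) else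
      (coloringInput b n s r L g).getD
        (5 + k % L.length * (r + m) + (r + (k / L.length - C))) 0) :
    g ∈ LinearMap.range (liftingMap F n s r) ↔
      ∀ j < m, FlatSolvable p L.length C M (C + j) := by
  have hset : ∀ i, ∃ A : Finset ℕ, i < C → A ⊆ Finset.range n ∧ A.card = s ∧ S i = bitMask A := by
    intro i
    by_cases hi : i < C
    · obtain ⟨A, hA, hc, hS⟩ := hP.exists_set i hi
      have h1 := hP.le i hi
      have h2 := hP.le_add i hi
      -- At level `n`, the bounds `h1` and `h2` leave only `K i = s`.
      exact ⟨A, fun _ => ⟨hA, by omega, hS⟩⟩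
    · exact ⟨∅, fun h => absurd h hi⟩
  choose A hA using hset
  have hcov : ∀ T ⊆ Finset.range n, T.card = s → ∃ j < C, A j = T := by
    intro T hT hs
    obtain ⟨j, hj, hS, -⟩ := hP.cover T hT hs
    rw [Finset.inter_eq_left.2 hT, (hA j hj).2.2] at hS
    exact ⟨j, hj, bitMask_injective hS⟩
  have hcol : ∀ j < C, ∀ i (hi : i < L.length), flatColumn p L.length M j i =
      if A j ⊆ (L[i]).1.map Fin.valEmbedding then 1 else 0 := by
    intro j hj i hi
    have hk := mul_add_lt hj hi
    rw [flatColumn, hM _ (hk.trans_le (Nat.mul_le_mul_right _ (by omega))), if_pos hk,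
      commonCount_coloringInput b L g hi (hA j hj).2.2]
    split_ifs with h
    · rw [Finset.inter_eq_left.2 h, (hA j hj).2.1]
      simp
    · have : (A j ∩ (L[i]).1.map Fin.valEmbedding).card < s := by
        rw [← (hA j hj).2.1]
        exact Finset.card_lt_card ⟨Finset.inter_subset_left, fun h' =>
          h (h'.trans Finset.inter_subset_right)⟩
      rw [show 1 - (s - (A j ∩ (L[i]).1.map Fin.valEmbedding).card) = 0 by omega, Nat.cast_zero]
  have hrhs : ∀ j : Fin m, ∀ i (hi : i < L.length), flatColumn p L.length M (C + j) i =
      b.repr (g L[i]) j := by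
    intro j i hi
    have hk : ¬(C + j) * L.length + i < C * L.length := by
      have := Nat.mul_le_mul_right L.length (Nat.le_add_right C j)
      omega
    obtain ⟨h1, h2⟩ := mul_add_div_mod (C + (j : ℕ)) hi
    rw [flatColumn, hM _ (mul_add_lt (by omega) hi), if_neg hk, h1, h2, Nat.add_sub_cancel_left,
      getD_coloringInput_color b L g hi j, ZMod.natCast_zmod_val]
  have key : ∀ j : Fin m, ((fun e => b.repr (g e) j) ∈ LinearMap.range (liftingMap (ZMod p) n s r) ↔
      FlatSolvable p L.length C M (C + j)) := by
    intro j
    rw [mem_range_liftingMap_iff (fun i hi => ⟨(hA i hi).1, (hA i hi).2.1⟩) hcov]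
    refine exists_congr fun c => ⟨fun h i hi => ?_, fun h e => ?_⟩
    · rw [hrhs j i hi, h]
      exact Finset.sum_congr rfl fun k hk => by rw [hcol k (Finset.mem_range.1 hk) i hi]
    · obtain ⟨i, hi, rfl⟩ := List.getElem_of_mem (hmem e)
      rw [← hrhs j i hi, h i hi]
      exact Finset.sum_congr rfl fun k hk => by rw [hcol k (Finset.mem_range.1 hk) i hi]
  rw [mem_range_liftingMap_iff_coord b g]
  exact ⟨fun h j hj => (key ⟨j, hj⟩).1 (h ⟨j, hj⟩), fun h j => (key j).2 (h j j.2)⟩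

theorem coloringInput_le {B : ℕ} (h1 : p ≤ B) (h2 : m ≤ B) (h3 : n ≤ B) (h4 : s ≤ B) (h5 : r ≤ B)
    (c : ℕ) : (coloringInput b n s r L g).getD c 0 ≤ B := by
  have hmem : ∀ v ∈ coloringInput b n s r L g, v ≤ B := by
    intro v hv
    simp only [coloringInput, List.mem_append, List.mem_flatMap, List.mem_map, List.mem_ofFn,
      List.mem_cons, List.not_mem_nil, or_false] at hv
    rcases hv with (rfl | rfl | rfl | rfl | rfl) | ⟨e, -, ⟨x, -, rfl⟩ | ⟨j, rfl⟩⟩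
    · exact h1
    · exact h2
    · exact h3
    · exact h4
    · exact h5
    · exact x.2.le.trans h3
    · exact (ZMod.val_lt _).le.trans h1
  by_cases hc : c < (coloringInput b n s r L g).length
  · rw [List.getD_eq_getElem _ _ hc]
    exact hmem _ (List.getElem_mem hc)
  · rw [List.getD_eq_default _ _ (by omega)]
    exact Nat.zero_le _

theorem decideImage_decidesWithin [Fintype F] (hs : 2 ≤ s) (hsr : s < r) (hrn : r ≤ n)
    (hL : L.Nodup) (hmem : ∀ e, e ∈ L) :
    RAM.decideImage.DecidesWithin (coloringInput b n s r L g)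
      (294 * RAM.decideImage.weight *
        (n.choose s + n.choose r + (Fintype.card F).size + 1) ^ 6)
      (g ∈ LinearMap.range (liftingMap F n s r)) := by
  classical
  obtain ⟨X, hX⟩ : ∃ X, n.choose s + n.choose r + (Fintype.card F).size = X := ⟨_, rfl⟩
  rw [hX]
  have hcard : Fintype.card F = p ^ m := by
    rw [Module.card_fintype b, ZMod.card, Fintype.card_fin]
  have hp2 : 2 ≤ p := (Fact.out : p.Prime).two_le
  have hqX : p ^ m < 2 ^ X := by
    rw [← hcard]
    exact (Nat.lt_size_self _).trans_le (Nat.pow_le_pow_right (by norm_num) (by omega))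
  -- A field has more than one element; `m ≠ 0` then gives `p ≤ p ^ m`.
  have hm0 : m ≠ 0 := by
    rintro rfl
    have := Fintype.one_lt_card (α := F)
    simp [hcard] at this
  have hmq : m ≤ (Fintype.card F).size := by
    have : m < (p ^ m).size := Nat.lt_size.2 (Nat.pow_le_pow_left hp2 m)
    rw [hcard]; omega
  have hn : n ≤ n.choose s := le_choose_self (by omega) (by omega)
  have hlen := Hyperedge.length_eq_choose hL hmem
  have hR : 0 < L.length := hlen ▸ Nat.choose_pos hrn
  -- A generous choice: `E` exceeds both the number of matrix entries and the number of input
  -- entries, which is the initial content of register `0`.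
  set E := 12 * (X + 1) ^ 2 with hEdef
  have hE : X * X + X + 1 ≤ E := by rw [hEdef]; nlinarith
  have hXE : X ≤ E := by nlinarith
  have hE2 : E ≤ 2 ^ E := Nat.lt_two_pow_self.le
  have hpE : p ≤ 2 ^ E := (Nat.le_self_pow hm0 p).trans
    (hqX.le.trans (Nat.pow_le_pow_right (by norm_num) hXE))
  have hlenE : 5 + L.length * (r + m) ≤ E := by
    have : L.length * (r + m) ≤ X * X := Nat.mul_le_mul (by omega) (by omega)
    rw [hEdef]
    nlinarith
  have hbdd : (RAM.State.init (coloringInput b n s r L g)).Bdd E := by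
    refine ⟨fun x => ?_, fun k i => ?_⟩
    · simp only [RAM.State.init, length_coloringInput]
      split_ifs <;> omega
    · simp only [RAM.State.init]
      split_ifs
      · exact coloringInput_le b g hpE (by omega) (by omega) (by omega) (by omega) i
      · omega
  obtain ⟨τ, t, hrun, ht, -, C, S, K, M, hP, hM, h0⟩ := RAM.decideImage_spec (E := E) (X := X)
    (p := p) (m := m) (n := n) (s := s) (r := r) (R := L.length)
    (σ := RAM.State.init (coloringInput b n s r L g)) rfl rfl rfl rfl rfl
    (length_coloringInput b L g) (fun k hk i => by simp [RAM.State.init, hk]) (by omega) hR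
    (by omega) (fun i hi t ht => getD_coloringInput_vertex_lt b L g hi ht)
    (fun i hi j hj => (getD_coloringInput_color b L g hi ⟨j, hj⟩).trans_lt (ZMod.val_lt _))
    (by omega) (by omega) (by omega) hE hpE (by omega) hbdd
  refine ⟨τ, t, hrun, ht.trans ?_, ?_⟩
  · have h1 : E + 2 ≤ 14 * (X + 1) ^ 2 := by rw [hEdef]; nlinarith
    calc 21 * (X + 1) ^ 4 * (RAM.decideImage.weight * (E + 2))
        ≤ 21 * (X + 1) ^ 4 * (RAM.decideImage.weight * (14 * (X + 1) ^ 2)) :=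
          Nat.mul_le_mul_left _ (Nat.mul_le_mul_left _ h1)
      _ = _ := by ring
  · rw [mem_range_liftingMap_iff_flatSolvable b g hmem hP hM, h0]
    exact ⟨fun h => if_pos h, fun h => if_neg h⟩

/-- The table lists all `r`-sets, which bounds `n.choose r`. The number of unknowns is only bounded
by `n ^ s`, so `s` enters the exponent: for `r = n` the table has a single row, whatever `n.choose
s` is. -/
theorem size_le_inputLength (hs : 0 < s) (hsr : s < r) (hrn : r ≤ n) (hL : L.Nodup)
    (hmem : ∀ e, e ∈ L) [Fintype F] :
    n.choose s + n.choose r + (Fintype.card F).size ≤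
      RAM.inputLength (coloringInput b n s r L g) ^ s +
        RAM.inputLength (coloringInput b n s r L g) +
        (RAM.inputLength (coloringInput b n s r L g) ^ 2 + 1) := by
  obtain ⟨N, hN⟩ : ∃ N, RAM.inputLength (coloringInput b n s r L g) = N := ⟨_, rfl⟩
  have hbit : ∀ l : List ℕ, l.length ≤ (l.map RAM.bitLen).sum := by
    intro l
    induction l with
    | nil => simp
    | cons a l ih => simp [RAM.bitLen]; omega
  have hlenN : 5 + L.length * (r + m) ≤ N := by
    rw [← length_coloringInput b L g (s := s), ← hN]
    exact hbit _
  have hpN : p.size ≤ N := by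
    rw [← hN, coloringInput, RAM.inputLength, List.cons_append, List.map_cons, List.sum_cons,
      RAM.bitLen]
    omega
  have hlen := Hyperedge.length_eq_choose hL hmem
  have hR : 0 < L.length := hlen ▸ Nat.choose_pos hrn
  have hRN : L.length ≤ L.length * (r + m) := Nat.le_mul_of_pos_right _ (by omega)
  have hmN : r + m ≤ L.length * (r + m) := Nat.le_mul_of_pos_left _ hR
  have hnN : n ≤ N := by
    -- For `r < n` the number of rows is at least `n`; for `r = n` the single row already lists `n`
    -- vertices.
    rcases hrn.lt_or_eq with h | h
    · have := le_choose_self (by omega) h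
      omega
    · omega
  have hcard : Fintype.card F = p ^ m := by
    rw [Module.card_fintype b, ZMod.card, Fintype.card_fin]
  have h1 : n.choose s ≤ N ^ s := (Nat.choose_le_pow n s).trans (Nat.pow_le_pow_left hnN s)
  have h2 : (Fintype.card F).size ≤ N ^ 2 + 1 := by
    rw [hcard, sq]
    exact Nat.size_pow_le.trans (Nat.add_le_add_right (Nat.mul_le_mul (by omega) hpN) 1)
  rw [hN]
  omega

end Decision

theorem RAM.Prog.DecidesWithin.mono {c : RAM.Prog} {l : List ℕ} {T T' : ℕ} {P : Prop}
    (h : c.DecidesWithin l T P) (hT : T ≤ T') : c.DecidesWithin l T' P := by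
  obtain ⟨τ, t, hr, ht, hP⟩ := h
  exact ⟨τ, t, hr, ht.trans hT, hP⟩

/-- One program decides, for all `2 ≤ s < r ≤ n`, all finite fields `F` (given by a basis over the
prime field) and all colourings `g` (given as a table, in any order of the hyperedges), whether `g`
lies in the image of the lifting map. Its running time is polynomial in the numbers of unknowns and
of equations and the bit length of the order of `F`; for fixed `s` and `r`, it is polynomial in the
bit length of the input. -/
theorem mainTheorem12 :
    ∃ c : RAM.Prog,
      (∃ P : Polynomial ℕ, ∀ (s r n : ℕ), 2 ≤ s → s < r → r ≤ n →
        ∀ (p m : ℕ) [Fact p.Prime] (F : Type u) [Field F] [Fintype F] [Algebra (ZMod p) F]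
          (b : Module.Basis (Fin m) (ZMod p) F)
          (L : List (Hyperedge n r)), L.Nodup → (∀ e, e ∈ L) →
          ∀ g : HyperedgeColoring F n r,
            c.DecidesWithin (coloringInput b n s r L g)
              (P.eval (n.choose s + n.choose r + (Fintype.card F).size))
              (g ∈ LinearMap.range (liftingMap F n s r))) ∧
      (∀ (s r : ℕ), 2 ≤ s → s < r → ∃ Q : Polynomial ℕ, ∀ n : ℕ, r ≤ n →
        ∀ (p m : ℕ) [Fact p.Prime] (F : Type u) [Field F] [Fintype F] [Algebra (ZMod p) F]
          (b : Module.Basis (Fin m) (ZMod p) F)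
          (L : List (Hyperedge n r)), L.Nodup → (∀ e, e ∈ L) →
          ∀ g : HyperedgeColoring F n r,
            c.DecidesWithin (coloringInput b n s r L g)
              (Q.eval (RAM.inputLength (coloringInput b n s r L g)))
              (g ∈ LinearMap.range (liftingMap F n s r))) := by

  refine ⟨RAM.decideImage,
    ⟨.C (294 * RAM.decideImage.weight) * (.X + 1) ^ 6, ?_⟩, fun s r hs hsr =>
    ⟨.C (294 * RAM.decideImage.weight) * (.X ^ s + .X + (.X ^ 2 + 1) + 1) ^ 6, ?_⟩⟩
  · intro s r n hs hsr hrn p m _ F _ _ _ b L hL hmem g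
    simpa using decideImage_decidesWithin b g hs hsr hrn hL hmem
  · intro n hrn p m _ F _ _ _ b L hL hmem g
    refine (decideImage_decidesWithin b g hs hsr hrn hL hmem).mono ?_
    simp only [Polynomial.eval_mul, Polynomial.eval_C, Polynomial.eval_pow, Polynomial.eval_add,
      Polynomial.eval_X, Polynomial.eval_one]
    exact Nat.mul_le_mul_left _ (Nat.pow_le_pow_left (Nat.add_le_add_right
      (size_le_inputLength b g (by omega) hsr hrn hL hmem) 1) 6)
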